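/- Let $A$ be a set of $N\ge 2$ arms, and let $p_{i,j}=1-p_{j,i}\in[0,1]$ be the probability that arm $i$ wins a duel between $i$ and $j$ (given the pulled arms, the outcome is independent of the past). Assume that some arm $w\in A$ is a Condorcet winner, $p_{w,i}>\tfrac12$ for all $i\ne w$, and let $p=\min\{p_{i,j}: p_{i,j}>\tfrac12\}$. Let $1<\beta<\frac{p}{1-p}$ (for $p=1$: $1<\beta<\infty$). *WS-W.* Let $C(i)$ be the number of duels won minus the number of duels lost by arm $i$ so far. In each step WS-W duels an arm $i$ maximizing $C$ over $A$ against an arm $j$ maximizing $C$ over $A\setminus\{i\}$; in both choices ties are broken in favour of the first arm of the pair that WS-W pulled last, then in favour of the second arm of that pair, and otherwise uniformly at random. Round $\ell$ of WS-W ($\ell=1,2,\dots$) starts right after round $\ell-1$ and ends as soon as some arm $Z(\ell)$ has $C(Z(\ell))=(N-1)\ell$ and all other arms have $C=-\ell$. *WS-S.* For $\ell=1,2,\dots$: run the $\ell$-th round of WS-W, then pull the pair $(Z(\ell),Z(\ell))$ for $\lfloor\beta^\ell\rfloor$ time periods, ignoring the feedback. Let $r(t)=0$ if the pair pulled at time $t$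 is $(w,w)$ and $r(t)=1$ otherwise, and let $R(T)=\sum_{t=1}^T r(t)$ be the cumulative strong regret of WS-S. Then for every integer $T\ge 0$ $$\mathbb E[R(T)]\le \frac{N^2p}{(2p-1)^2}+\frac{N\log(1+T(\beta-1))}{(2p-1)\log\beta},$$ and whenever $T(\beta-1)\ge 2$, moreover $$\mathbb E[R(T)]\le \frac{N^2p}{(2p-1)^2}+\frac{N\log(T(\beta-1))}{(2p-1)\log\beta}.$$ In particular $\mathbb E[R(T)]=O(N^2+N\log T)$: there is a constant $K$ depending only on $p$ and $\beta$ such that $\mathbb E[R(T)]\le K(N^2+N\log T)$ for all $T\ge1$, all $N\ge 2$ and all such preference probabilities. -/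

import Mathlib

open scoped ENNReal

universe u

noncomputable section

namespace DuelingBandits

/-- The preference probabilities of a dueling bandit problem with set of arms `A`:
`prob i j` is the probability that arm `i` wins a duel between the arms `i` and `j`. -/
structure Preferences (A : Type u) where
  prob : A → A → ℝ
  prob_nonneg : ∀ i j, 0 ≤ prob i j
  prob_add_swap : ∀ i j, prob i j + prob j i = 1

namespace Preferences

variable {A : Type u} (P : Preferences A)

/-- Arm `w` is a Condorcet winner: it beats every other arm with probability above `1/2`. -/
def IsCondorcetWinner (w : A) : Prop :=
  ∀ i, i ≠ w → 1 / 2 < P.prob w i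

/-- `p` is the least of the preference probabilities that exceed `1/2`. -/
def IsMinPreference (p : ℝ) : Prop :=
  IsLeast {x : ℝ | 1 / 2 < x ∧ ∃ i j, P.prob i j = x} p

/-- The feedback of a duel between `i` and `j`; `true` means that `i` wins. -/
def duel (i j : A) : PMF Bool :=
  PMF.ofFintype (fun b => ENNReal.ofReal (if b then P.prob i j else P.prob j i)) (by
    have h := ENNReal.ofReal_add (P.prob_nonneg i j) (P.prob_nonneg j i)
    rw [P.prob_add_swap, ENNReal.ofReal_one] at h
    simpa using h.symm)

end Preferences

/-! ### The algorithm WS-W -/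

/-- The data on which the next pull of WS-W depends. -/
structure WSW (A : Type u) where
  /-- `wins i j` is the number of duels so far in which `i` defeated `j` -/
  wins : A → A → ℕ
  /-- the pair of arms pulled last, if any -/
  last : Option (A × A)

namespace WSW

variable {A : Type u}

/-- WS-W before its first pull. -/
def init (A : Type u) : WSW A where
  wins := fun _ _ => 0
  last := none

variable [DecidableEq A]

/-- Record a duel between `i` and `j`, won by `i` if `b` is `true` and by `j` otherwise. -/
def record (s : WSW A) (i j : A) (b : Bool) : WSW A where
  wins := fun k l =>
    if (k, l) = (if b then (i, j) else (j, i)) then s.wins k l + 1 else s.wins k l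
  last := some (i, j)

variable [Fintype A]

/-- `C i`, the number of duels won by arm `i` minus the number of duels lost by arm `i`. -/
def score (s : WSW A) (i : A) : ℤ :=
  ∑ j ∈ Finset.univ.erase i, ((s.wins i j : ℤ) - (s.wins j i : ℤ))

/-- The set of maximizers of the score over the set `S`. -/
def argmax (s : WSW A) (S : Finset A) : Finset A :=
  {i ∈ S | ∀ k ∈ S, s.score k ≤ s.score i}

theorem argmax_nonempty (s : WSW A) {S : Finset A} (hS : S.Nonempty) :
    (s.argmax S).Nonempty := by
  obtain ⟨i, hi, h⟩ := Finset.exists_max_image S s.score hS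
  exact ⟨i, Finset.mem_filter.2 ⟨hi, h⟩⟩

/-- Choose a maximizer of the score over `S`. Ties are broken in favour of the first arm of the
last pulled pair, then in favour of its second arm, and otherwise uniformly at random. -/
def pick (s : WSW A) (S : Finset A) (hS : S.Nonempty) : PMF A :=
  match s.last with
  | none => PMF.uniformOfFinset (s.argmax S) (s.argmax_nonempty hS)
  | some (i, j) =>
    if i ∈ s.argmax S then PMF.pure i
    else if j ∈ s.argmax S then PMF.pure j
    else PMF.uniformOfFinset (s.argmax S) (s.argmax_nonempty hS)

theorem erase_nonempty [Nontrivial A] (i : A) : (Finset.univ.erase i : Finset A).Nonempty := by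
  obtain ⟨j, hj⟩ := exists_ne i
  exact ⟨j, Finset.mem_erase.2 ⟨hj, Finset.mem_univ j⟩⟩

/-- The pair of arms pulled next: the first arm maximizes the score over all arms, the second one
maximizes it over all the other arms. -/
def choosePair [Nontrivial A] (s : WSW A) : PMF (A × A) :=
  (s.pick Finset.univ Finset.univ_nonempty).bind fun i =>
    (s.pick (Finset.univ.erase i) (erase_nonempty i)).map fun j => (i, j)

/-- One step of WS-W: choose two arms and let them duel. The result is the pulled pair together
with the new state. -/
def step [Nontrivial A] (P : Preferences A) (s : WSW A) : PMF ((A × A) × WSW A) :=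
  s.choosePair.bind fun a =>
    (P.duel a.1 a.2).map fun b => (a, s.record a.1 a.2 b)

/-- The score pattern that marks the end of round `ℓ` with winner `z`: arm `z` has score
`(N - 1) ℓ`, where `N` is the number of arms, and every other arm has score `-ℓ`. -/
def RoundWonBy (s : WSW A) (ℓ : ℕ) (z : A) : Prop :=
  s.score z = ((Fintype.card A : ℤ) - 1) * (ℓ : ℤ) ∧ ∀ i, i ≠ z → s.score i = -(ℓ : ℤ)

end WSW

/-! ### The algorithm WS-S -/

/-- What WS-S does in the next time period. -/
inductive Phase (A : Type u) where
  /-- run WS-W for one more pull -/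
  | explore : Phase A
  /-- pull the pair `(z, z)`, and do so for `n` further time periods after that one -/
  | exploit (z : A) (n : ℕ) : Phase A

/-- The state of WS-S between two time periods. -/
structure WSS (A : Type u) where
  /-- the state of the subroutine WS-W -/
  sub : WSW A
  /-- the index of the current round, starting from `1` -/
  round : ℕ
  /-- the current phase -/
  phase : Phase A

namespace WSS

variable {A : Type u}

/-- WS-S before its first pull. -/
def init (A : Type u) : WSS A where
  sub := WSW.init A
  round := 1
  phase := Phase.explore

/-- The state of WS-S in round `ℓ` when `n` time periods of exploitation with arm `z` are left. -/
def exploiting (s : WSW A) (ℓ : ℕ) (z : A) : ℕ → WSS A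
  | 0 => { sub := s, round := ℓ + 1, phase := Phase.explore }
  | n + 1 => { sub := s, round := ℓ, phase := Phase.exploit z n }

variable [DecidableEq A] [Fintype A]

open Classical in
/-- The state of WS-S after a pull of WS-W in round `ℓ` that left WS-W in state `s`: if the round
is over, and `z` is its winner, then `z` is exploited for `⌊β ^ ℓ⌋` time periods; otherwise
exploration goes on. -/
def afterDuel (β : ℝ) (s : WSW A) (ℓ : ℕ) : WSS A :=
  if h : ∃ z, s.RoundWonBy ℓ z then exploiting s ℓ h.choose ⌊β ^ ℓ⌋₊
  else { sub := s, round := ℓ, phase := Phase.explore }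

/-- One time period of WS-S with parameter `β`. The result is the pulled pair together with the
new state. Nothing is recorded in the exploitation phase. -/
def step [Nontrivial A] (P : Preferences A) (β : ℝ) (s : WSS A) : PMF ((A × A) × WSS A) :=
  match s.phase with
  | Phase.explore => (s.sub.step P).map fun x => (x.1, afterDuel β x.2 s.round)
  | Phase.exploit z n => PMF.pure ((z, z), exploiting s.sub s.round z n)

/-- The joint law of the list of the pairs pulled in the time periods `1, …, T` (latest first)
and of the state of WS-S after time period `T`. -/
def run [Nontrivial A] (P : Preferences A) (β : ℝ) : ℕ → PMF (List (A × A) × WSS A)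
  | 0 => PMF.pure ([], init A)
  | T + 1 => (run P β T).bind fun x =>
      (step P β x.2).map fun y => (y.1 :: x.1, y.2)

end WSS

/-- The single-period (binary) strong regret of pulling the pair `a`, when `w` is the best arm. -/
def strongRegret {A : Type u} [DecidableEq A] (w : A) (a : A × A) : ℕ :=
  if a.1 = w ∧ a.2 = w then 0 else 1

/-- The expected cumulative strong regret of WS-S with parameter `β` up to time `T`, when `w` is
the best arm. -/
def WSS.expectedStrongRegret {A : Type u} [DecidableEq A] [Fintype A] [Nontrivial A]
    (P : Preferences A) (β : ℝ) (w : A) (T : ℕ) : ℝ≥0∞ :=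
  ∑' x, WSS.run P β T x * (((x.1.map (strongRegret w)).sum : ℕ) : ℝ≥0∞)

end DuelingBandits

end

/-! Suppose p < 1 and put r = (1-p)/p. Round m+1 of WS-W consists of N-1 iterations: an incumbent
duels one fresh challenger until one of the two drops to score -(m+1) and is out for the round; the
survivor is the next incumbent. After c iterations of the round, the next one is a gambler's ruin on
{0, …, Nm+c+2} started one step below the top. If the incumbent is favoured, it lasts at most
1/(2p-1) duels on average; otherwise at most (Nm+c+1)/p (`exists_duelPotential`).

In the second case the incumbent is not w, so C(w) ≤ -m and 1 ≤ r^m r^C(w)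
(`one_le_pow_mul_weight`). Since r^C(w) is a supermartingale started at 1, the long iterations
contribute at most r^m (Nm+c+1)/p each in expectation. In the same way, exploiting a wrong arm after
round m+1 forces C(w) = -(m+1) and costs at most (βr)^(m+1). `bounds` turns this into an induction
on the number of time periods left, with costs affine in r^C(w).

Summing over the rounds gives `explicitCost`, with M bounding the number of rounds that start by
time T. The exploitation phases grow geometrically, so M log β ≤ log(1+T(β-1)). Replacing 1+T(β-1)
by T(β-1) needs the finer estimate `rounds_mul_le`. As the weight degenerates at p = 1, the argument
runs for q < p and q tends to p. -/

noncomputable section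

/-! ### Expectations, and the regret as a backward recursion. -/

namespace PMF

variable {α γ : Type*}

/-- The expectation of a function with values in `[0, ∞]`. -/
def expect (μ : PMF α) (g : α → ℝ≥0∞) : ℝ≥0∞ :=
  ∑' a, μ a * g a

theorem expect_pure (a : α) (g : α → ℝ≥0∞) : (PMF.pure a).expect g = g a := by
  unfold expect
  rw [tsum_eq_single a]
  · simp
  · intro b hb
    simp [PMF.pure_apply, hb]

theorem expect_bind (μ : PMF α) (κ : α → PMF γ) (g : γ → ℝ≥0∞) :
    (μ.bind κ).expect g = μ.expect fun a => (κ a).expect g := by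
  unfold expect
  simp only [PMF.bind_apply, ← ENNReal.tsum_mul_right, ← ENNReal.tsum_mul_left]
  rw [ENNReal.tsum_comm]
  simp only [mul_assoc]

theorem expect_map (μ : PMF α) (h : α → γ) (g : γ → ℝ≥0∞) :
    (μ.map h).expect g = μ.expect fun a => g (h a) := by
  rw [PMF.map, expect_bind]
  simp only [Function.comp_apply, expect_pure]

theorem expect_const_add (μ : PMF α) (c : ℝ≥0∞) (g : α → ℝ≥0∞) :
    (μ.expect fun a => c + g a) = c + μ.expect g := by
  unfold expect
  simp only [mul_add, ENNReal.tsum_add, ENNReal.tsum_mul_right, PMF.tsum_coe, one_mul]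

theorem expect_le_of_support (μ : PMF α) {g : α → ℝ≥0∞} {c : ℝ≥0∞}
    (h : ∀ a ∈ μ.support, g a ≤ c) : μ.expect g ≤ c := by
  calc μ.expect g ≤ ∑' a, μ a * c := by
        refine ENNReal.tsum_le_tsum fun a => ?_
        by_cases ha : μ a = 0
        · simp [ha]
        · exact mul_le_mul_right (h a ((PMF.mem_support_iff _ _).2 ha)) _
    _ = c := by rw [ENNReal.tsum_mul_right, PMF.tsum_coe, one_mul]

end PMF

namespace DuelingBandits

theorem Preferences.expect_duel {A : Type u} (P : Preferences A) (i j : A) (g : Bool → ℝ≥0∞) :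
    (P.duel i j).expect g =
      ENNReal.ofReal (P.prob i j) * g true + ENNReal.ofReal (P.prob j i) * g false := by
  unfold PMF.expect Preferences.duel
  rw [tsum_bool, add_comm]
  simp

variable {A : Type u} [DecidableEq A] [Fintype A]

namespace WSS

variable [Nontrivial A]

/-- The expected strong regret of WS-S in the next `n` time periods, from a given state. -/
def futureRegret (P : Preferences A) (β : ℝ) (w : A) : ℕ → WSS A → ℝ≥0∞
  | 0, _ => 0
  | n + 1, s => (step P β s).expect fun y =>
      (strongRegret w y.1 : ℝ≥0∞) + futureRegret P β w n y.2

/-- Past regret plus expected future regret does not depend on the time of splitting; each induction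
step moves one period from the future to the past. -/
theorem expect_run_add_futureRegret (P : Preferences A) (β : ℝ) (w : A) (T n : ℕ) :
    ((run P β T).expect fun x =>
      (((x.1.map (strongRegret w)).sum : ℕ) : ℝ≥0∞) + futureRegret P β w n x.2) =
      futureRegret P β w (T + n) (init A) := by
  induction T generalizing n with
  | zero => simp [run, PMF.expect_pure]
  | succ T ih =>
    have h : T + 1 + n = T + (n + 1) := by omega
    rw [h, ← ih (n + 1), run, PMF.expect_bind]
    congr 1
    funext x
    rw [PMF.expect_map, futureRegret, ← PMF.expect_const_add]
    congr 1
    funext y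
    simp only [List.map_cons, List.sum_cons, Nat.cast_add]
    ring

theorem expectedStrongRegret_eq_futureRegret (P : Preferences A) (β : ℝ) (w : A) (T : ℕ) :
    expectedStrongRegret P β w T = futureRegret P β w T (init A) := by
  have h := expect_run_add_futureRegret P β w T 0
  simp only [futureRegret, add_zero] at h
  exact h

end WSS

/-! ### Scores during a round of WS-W. -/

namespace WSW

theorem score_record (s : WSW A) {i j : A} (hij : i ≠ j) (b : Bool) (x : A) :
    (s.record i j b).score x = s.score x +
      ((if x = (if b then i else j) then 1 else 0) -
        (if x = (if b then j else i) then 1 else 0)) := by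
  have key : ∀ a c : A, a ≠ c → ∀ s' : WSW A,
      (∀ k l, s'.wins k l = if (k, l) = (a, c) then s.wins k l + 1 else s.wins k l) →
      s'.score x = s.score x + ((if x = a then 1 else 0) - (if x = c then 1 else 0)) := by
    intro a c hac s' hs'
    have h1 : ∀ l ∈ Finset.univ.erase x, ((s'.wins x l : ℤ) - (s'.wins l x : ℤ)) =
        ((s.wins x l : ℤ) - (s.wins l x : ℤ)) +
          ((if l = c then (if x = a then 1 else 0) else 0) -
            (if l = a then (if x = c then 1 else 0) else 0)) := by
      intro l hl
      rw [hs', hs']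
      simp only [Prod.mk.injEq]
      by_cases h1 : x = a <;> by_cases h2 : l = c <;> by_cases h3 : l = a <;>
        by_cases h4 : x = c <;> simp [h1, h2, h3, h4] <;> simp_all <;> ring
    unfold score
    rw [Finset.sum_congr rfl h1, Finset.sum_add_distrib]
    congr 1
    rw [Finset.sum_sub_distrib, Finset.sum_ite_eq', Finset.sum_ite_eq']
    by_cases h1 : x = a <;> by_cases h4 : x = c <;> simp_all
    · exact fun h => hac h.symm
  cases b
  · exact key j i hij.symm _ fun k l => by simp [record]
  · exact key i j hij _ fun k l => by simp [record]

end WSW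

end DuelingBandits

namespace DuelingBandits

variable {A : Type u} [DecidableEq A] [Fintype A]

namespace WSW

theorem mem_argmax {s : WSW A} {S : Finset A} {i : A} :
    i ∈ s.argmax S ↔ i ∈ S ∧ ∀ k ∈ S, s.score k ≤ s.score i :=
  Finset.mem_filter

theorem mem_argmax_of_mem_support_pick (s : WSW A) (S : Finset A) (hS : S.Nonempty) {i : A}
    (hi : i ∈ (s.pick S hS).support) : i ∈ s.argmax S := by
  unfold pick at hi
  split at hi
  · simpa using hi
  · split_ifs at hi with h1 h2
    · rw [PMF.support_pure, Set.mem_singleton_iff] at hi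
      rwa [hi]
    · rw [PMF.support_pure, Set.mem_singleton_iff] at hi
      rwa [hi]
    · simpa using hi

theorem pick_eq_first {s : WSW A} {S : Finset A} (hS : S.Nonempty) {i j : A}
    (hl : s.last = some (i, j)) (hi : i ∈ s.argmax S) : s.pick S hS = PMF.pure i := by
  unfold pick
  rw [hl]
  simp [hi]

theorem pick_eq_second {s : WSW A} {S : Finset A} (hS : S.Nonempty) {i j : A}
    (hl : s.last = some (i, j)) (hi : i ∉ s.argmax S) (hj : j ∈ s.argmax S) :
    s.pick S hS = PMF.pure j := by
  unfold pick
  rw [hl]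
  simp [hi, hj]

theorem mem_support_choosePair [Nontrivial A] {s : WSW A} {a : A × A}
    (ha : a ∈ s.choosePair.support) :
    a.1 ∈ s.argmax Finset.univ ∧ a.2 ∈ s.argmax (Finset.univ.erase a.1) := by
  unfold choosePair at ha
  rw [PMF.mem_support_bind_iff] at ha
  obtain ⟨i, hi, h⟩ := ha
  rw [PMF.mem_support_map_iff] at h
  obtain ⟨j, hj, rfl⟩ := h
  exact ⟨mem_argmax_of_mem_support_pick _ _ _ hi, mem_argmax_of_mem_support_pick _ _ _ hj⟩

/-- An iteration of round `m + 1` starts: the arms in `F` have already lost an iteration of that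
round, and `i` is the incumbent. -/
structure IterationStart (s : WSW A) (m : ℕ) (F : Finset A) (i : A) : Prop where
  notMem : i ∉ F
  score_incumbent : s.score i = ((Fintype.card A : ℤ) - 1) * m + F.card
  score_loser : ∀ x ∈ F, s.score x = -((m : ℤ) + 1)
  score_fresh : ∀ x ∉ F, x ≠ i → s.score x = -(m : ℤ)

/-- An iteration of round `m + 1` between the arms `i` and `j` is going on: the arms in `F` have
already lost an iteration of that round, arm `i` loses the iteration once it has lost `y` more
duels than it has won from now on, and arm `j` loses it once it has lost
`N * m + #F + 2 - y` more duels than it has won. -/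
structure Dueling (s : WSW A) (m : ℕ) (F : Finset A) (i j : A) (y : ℕ) : Prop where
  ne : i ≠ j
  notMem_left : i ∉ F
  notMem_right : j ∉ F
  le : y ≤ Fintype.card A * m + F.card + 2
  score_left : s.score i = (y : ℤ) - (m + 1)
  score_right : s.score j =
    ((Fintype.card A * m + F.card + 2 : ℕ) : ℤ) - y - (m + 1)
  score_loser : ∀ x ∈ F, s.score x = -((m : ℤ) + 1)
  score_fresh : ∀ x ∉ F, x ≠ i → x ≠ j → s.score x = -(m : ℤ)

theorem iterationStart_init (i : A) : IterationStart (init A) 0 ∅ i where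
  notMem := by simp
  score_incumbent := by simp [score, init]
  score_loser := by simp
  score_fresh := by simp [score, init]

variable {s : WSW A} {m : ℕ} {F : Finset A} {i j : A} {y : ℕ}

/-- The distances of the two duellists from the losing score -(m+1) have the constant sum N * m + #F
+ 2, so their roles are symmetric. -/
theorem Dueling.swap (h : Dueling s m F i j y) :
    Dueling s m F j i (Fintype.card A * m + F.card + 2 - y) where
  ne := h.ne.symm
  notMem_left := h.notMem_right
  notMem_right := h.notMem_left
  le := Nat.sub_le _ _
  score_left := by
    rw [h.score_right, Nat.cast_sub h.le]
  score_right := by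
    rw [h.score_left, Nat.cast_sub h.le]
    ring
  score_loser := h.score_loser
  score_fresh := fun x hx h1 h2 => h.score_fresh x hx h2 h1

theorem Dueling.record_true (h : Dueling s m F i j y)
    (hy : y < Fintype.card A * m + F.card + 2) :
    Dueling (s.record i j true) m F i j (y + 1) where
  ne := h.ne
  notMem_left := h.notMem_left
  notMem_right := h.notMem_right
  le := hy
  score_left := by
    rw [score_record s h.ne, h.score_left]
    simp [h.ne]
    ring
  score_right := by
    rw [score_record s h.ne, h.score_right]
    simp [h.ne.symm]
    ring
  score_loser := fun x hx => by
    have h1 : x ≠ i := fun e => h.notMem_left (e ▸ hx)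
    have h2 : x ≠ j := fun e => h.notMem_right (e ▸ hx)
    rw [score_record s h.ne, h.score_loser x hx]
    simp [h1, h2]
  score_fresh := fun x hx h1 h2 => by
    rw [score_record s h.ne, h.score_fresh x hx h1 h2]
    simp [h1, h2]

theorem Dueling.record_false (h : Dueling s m F i j (y + 1)) :
    Dueling (s.record i j false) m F i j y where
  ne := h.ne
  notMem_left := h.notMem_left
  notMem_right := h.notMem_right
  le := (Nat.le_succ y).trans h.le
  score_left := by
    rw [score_record s h.ne, h.score_left]
    simp [h.ne]
    ring
  score_right := by
    rw [score_record s h.ne, h.score_right]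
    simp [h.ne.symm]
    ring
  score_loser := fun x hx => by
    have h1 : x ≠ i := fun e => h.notMem_left (e ▸ hx)
    have h2 : x ≠ j := fun e => h.notMem_right (e ▸ hx)
    rw [score_record s h.ne, h.score_loser x hx]
    simp [h1, h2]
  score_fresh := fun x hx h1 h2 => by
    rw [score_record s h.ne, h.score_fresh x hx h1 h2]
    simp [h1, h2]

theorem Dueling.iterationStart (h : Dueling s m F i j 0) :
    IterationStart s m (insert i F) j where
  notMem := by
    simp [h.notMem_right, h.ne.symm]
  score_incumbent := by
    rw [h.score_right, Finset.card_insert_of_notMem h.notMem_left]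
    push_cast
    ring
  score_loser := fun x hx => by
    rcases Finset.mem_insert.1 hx with rfl | hx
    · rw [h.score_left]
      simp
    · exact h.score_loser x hx
  score_fresh := fun x hx h1 => by
    rw [Finset.mem_insert, not_or] at hx
    exact h.score_fresh x hx.2 hx.1 h1

theorem Dueling.score_other_le (h : Dueling s m F i j y) {x : A} (hi : x ≠ i) (hj : x ≠ j) :
    s.score x ≤ -(m : ℤ) := by
  by_cases hx : x ∈ F
  · rw [h.score_loser x hx]
    omega
  · exact (h.score_fresh x hx hi hj).le

/-- Both duellists have score at least -m and all other arms at most -m. A fresh arm can tie with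
the trailing duellist, and then the tie-breaking rule keeps the pair together. The order flips when
`j` is strictly ahead. -/
theorem Dueling.mem_support_choosePair [Nontrivial A] (h : Dueling s m F i j y) (hy : 0 < y)
    (hy' : y < Fintype.card A * m + F.card + 2) (hl : s.last = some (i, j)) {a : A × A}
    (ha : a ∈ s.choosePair.support) : a = (i, j) ∨ a = (j, i) := by
  have hi : -(m : ℤ) ≤ s.score i := by rw [h.score_left]; omega
  have hj : -(m : ℤ) ≤ s.score j := by rw [h.score_right]; omega
  have other : ∀ x, x ≠ i → x ≠ j → s.score x ≤ -(m : ℤ) := fun x => h.score_other_le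
  unfold choosePair at ha
  rw [PMF.mem_support_bind_iff] at ha
  obtain ⟨k, hk, h'⟩ := ha
  rw [PMF.mem_support_map_iff] at h'
  obtain ⟨l, hl', rfl⟩ := h'
  by_cases hij : s.score j ≤ s.score i
  · have him : i ∈ s.argmax Finset.univ := by
      refine mem_argmax.2 ⟨Finset.mem_univ _, fun x _ => ?_⟩
      by_cases h1 : x = i
      · rw [h1]
      · by_cases h2 : x = j
        · rwa [h2]
        · exact (other x h1 h2).trans hi
    rw [pick_eq_first _ hl him, PMF.support_pure, Set.mem_singleton_iff] at hk
    subst hk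
    have hjm : j ∈ s.argmax (Finset.univ.erase k) := by
      refine mem_argmax.2 ⟨by simp [h.ne.symm], fun x hx => ?_⟩
      by_cases h2 : x = j
      · rw [h2]
      · exact (other x (Finset.ne_of_mem_erase hx) h2).trans hj
    have him' : k ∉ s.argmax (Finset.univ.erase k) := fun h => by
      simpa using (mem_argmax.1 h).1
    rw [pick_eq_second _ hl him' hjm, PMF.support_pure, Set.mem_singleton_iff] at hl'
    exact Or.inl (by rw [hl'])
  · have him : i ∉ s.argmax Finset.univ := fun h =>
      hij ((mem_argmax.1 h).2 j (Finset.mem_univ _))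
    have hjm : j ∈ s.argmax Finset.univ := by
      refine mem_argmax.2 ⟨Finset.mem_univ _, fun x _ => ?_⟩
      by_cases h2 : x = j
      · rw [h2]
      · by_cases h1 : x = i
        · rw [h1]
          exact (not_le.1 hij).le
        · exact (other x h1 h2).trans hj
    rw [pick_eq_second _ hl him hjm, PMF.support_pure, Set.mem_singleton_iff] at hk
    subst hk
    have him' : i ∈ s.argmax (Finset.univ.erase k) := by
      refine mem_argmax.2 ⟨by simp [h.ne], fun x hx => ?_⟩
      by_cases h1 : x = i
      · rw [h1]
      · exact (other x h1 (Finset.ne_of_mem_erase hx)).trans hi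
    rw [pick_eq_first _ hl him', PMF.support_pure, Set.mem_singleton_iff] at hl'
    exact Or.inr (by rw [hl'])

theorem IterationStart.score_le (h : IterationStart s m F i) (x : A) : s.score x ≤ s.score i := by
  have hN : (1 : ℤ) ≤ Fintype.card A := by
    exact_mod_cast Fintype.card_pos_iff.2 ⟨i⟩
  have hm : 0 ≤ ((Fintype.card A : ℤ) - 1) * m :=
    mul_nonneg (by linarith) (Int.natCast_nonneg m)
  by_cases h1 : x = i
  · rw [h1]
  · rw [h.score_incumbent]
    by_cases hx : x ∈ F
    · rw [h.score_loser x hx]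
      omega
    · rw [h.score_fresh x hx h1]
      omega

theorem IterationStart.exists_fresh (h : IterationStart s m F i)
    (hF : F.card + 1 < Fintype.card A) : ∃ x, x ∉ F ∧ x ≠ i := by
  by_contra! hc
  have : (insert i F).card = Fintype.card A := by
    rw [Finset.card_eq_iff_eq_univ]
    ext x
    simp only [Finset.mem_insert, Finset.mem_univ, iff_true]
    by_cases hx : x ∈ F
    · exact Or.inr hx
    · exact Or.inl (hc x hx)
  rw [Finset.card_insert_of_notMem h.notMem] at this
  omega

theorem IterationStart.card_lt (h : IterationStart s m F i) : F.card + 1 ≤ Fintype.card A := by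
  rw [← Finset.card_insert_of_notMem h.notMem]
  exact Finset.card_le_univ _

/-- A maximizer other than `i` must be a fresh arm tied with `i` at score -m, and the two are then
interchangeable. This covers the random choice at the very first pull. -/
theorem IterationStart.of_mem_argmax (h : IterationStart s m F i)
    (hF : F.card + 1 < Fintype.card A) (hj : j ∈ s.argmax Finset.univ) :
    IterationStart s m F j := by
  have hji : s.score j = s.score i :=
    le_antisymm (h.score_le j) ((mem_argmax.1 hj).2 i (Finset.mem_univ _))
  by_cases h1 : j = i
  · rwa [h1]
  have hN : (2 : ℤ) ≤ Fintype.card A := by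
    exact_mod_cast (show 2 ≤ Fintype.card A by omega)
  have hi := h.score_incumbent
  have hj' : j ∉ F := fun hx => by
    have := h.score_loser j hx
    nlinarith [Int.natCast_nonneg m, Int.natCast_nonneg F.card]
  have hj2 := h.score_fresh j hj' h1
  have hi2 : s.score i = -(m : ℤ) := by rw [← hji, hj2]
  refine ⟨hj', by rw [hji, hi], h.score_loser, fun x hx hxj => ?_⟩
  by_cases hxi : x = i
  · rw [hxi, hi2]
  · exact h.score_fresh x hx hxi

theorem IterationStart.dueling (h : IterationStart s m F i)
    (hF : F.card + 1 < Fintype.card A) (hj : j ∈ s.argmax (Finset.univ.erase i)) :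
    Dueling s m F i j (Fintype.card A * m + F.card + 1) := by
  obtain ⟨x, hx, hxi⟩ := h.exists_fresh hF
  have hji : j ≠ i := Finset.ne_of_mem_erase (mem_argmax.1 hj).1
  have hle := (mem_argmax.1 hj).2 x (Finset.mem_erase.2 ⟨hxi, Finset.mem_univ _⟩)
  rw [h.score_fresh x hx hxi] at hle
  have hjF : j ∉ F := fun hjF => by
    rw [h.score_loser j hjF] at hle
    omega
  refine ⟨hji.symm, h.notMem, hjF, by omega, ?_, ?_, h.score_loser,
    fun x hx h1 _ => h.score_fresh x hx h1⟩
  · rw [h.score_incumbent]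
    push_cast
    ring
  · rw [h.score_fresh j hjF hji]
    push_cast
    ring

theorem RoundWonBy.eq_of_score_ne {ℓ : ℕ} {z x : A} (h : s.RoundWonBy ℓ z)
    (hx : s.score x ≠ -(ℓ : ℤ)) : x = z := by
  by_contra hxz
  exact hx (h.2 x hxz)

theorem Dueling.not_roundWonBy (h : Dueling s m F i j y) (hy : 0 < y)
    (hy' : y < Fintype.card A * m + F.card + 2) : ¬ ∃ z, s.RoundWonBy (m + 1) z := by
  rintro ⟨z, hz⟩
  have hi : s.score i ≠ -((m + 1 : ℕ) : ℤ) := by rw [h.score_left]; omega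
  have hj : s.score j ≠ -((m + 1 : ℕ) : ℤ) := by rw [h.score_right]; omega
  exact h.ne ((hz.eq_of_score_ne hi).trans (hz.eq_of_score_ne hj).symm)

theorem IterationStart.not_roundWonBy (h : IterationStart s m F i)
    (hF : F.card + 1 < Fintype.card A) : ¬ ∃ z, s.RoundWonBy (m + 1) z := by
  rintro ⟨z, hz⟩
  obtain ⟨x, hx, hxi⟩ := h.exists_fresh hF
  have h1 : s.score x ≠ -((m + 1 : ℕ) : ℤ) := by rw [h.score_fresh x hx hxi]; omega
  have h2 : s.score i ≠ -((m + 1 : ℕ) : ℤ) := by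
    have := h.score_le x
    rw [h.score_fresh x hx hxi] at this
    omega
  exact hxi ((hz.eq_of_score_ne h1).trans (hz.eq_of_score_ne h2).symm)

theorem IterationStart.score_of_last (h : IterationStart s m F i)
    (hF : F.card + 1 = Fintype.card A) {x : A} (hx : x ≠ i) :
    s.score x = -((m : ℤ) + 1) := by
  refine h.score_loser x ?_
  have : insert i F = Finset.univ := by
    rw [← Finset.card_eq_iff_eq_univ, Finset.card_insert_of_notMem h.notMem, hF]
  have hx' := Finset.mem_univ x
  rw [← this, Finset.mem_insert] at hx'
  exact hx'.resolve_left hx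

theorem IterationStart.score_incumbent_of_last (h : IterationStart s m F i)
    (hF : F.card + 1 = Fintype.card A) :
    s.score i = ((Fintype.card A : ℤ) - 1) * ((m : ℤ) + 1) := by
  have : (F.card : ℤ) + 1 = Fintype.card A := by exact_mod_cast hF
  rw [h.score_incumbent, ← this]
  ring

theorem IterationStart.roundWonBy (h : IterationStart s m F i)
    (hF : F.card + 1 = Fintype.card A) : s.RoundWonBy (m + 1) i := by
  refine ⟨?_, fun x hx => ?_⟩
  · rw [h.score_incumbent_of_last hF]
    push_cast
    rfl
  · rw [h.score_of_last hF hx]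
    push_cast
    rfl

theorem IterationStart.next_round (h : IterationStart s m F i)
    (hF : F.card + 1 = Fintype.card A) : IterationStart s (m + 1) ∅ i := by
  refine ⟨by simp, ?_, by simp, fun x _ hx => ?_⟩
  · rw [h.score_incumbent_of_last hF]
    simp
  · rw [h.score_of_last hF hx]
    push_cast
    rfl

/-- Identifies the arm that `afterDuel` selects by choice: the incumbent's score is positive, hence
not that of a loser. -/
theorem IterationStart.eq_of_roundWonBy [Nontrivial A] (h : IterationStart s m F i)
    (hF : F.card + 1 = Fintype.card A) {z : A} (hz : s.RoundWonBy (m + 1) z) : z = i := by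
  refine (hz.eq_of_score_ne ?_).symm
  rw [h.score_incumbent_of_last hF]
  have hN : (2 : ℤ) ≤ Fintype.card A := by
    exact_mod_cast Fintype.one_lt_card (α := A)
  push_cast
  nlinarith [Int.natCast_nonneg m]

end WSW

namespace WSS

open WSW

variable {s : WSW A} {m : ℕ} {F : Finset A} {i j : A} {y : ℕ} (β : ℝ)

theorem afterDuel_of_dueling (h : Dueling s m F i j y) (hy : 0 < y)
    (hy' : y < Fintype.card A * m + F.card + 2) :
    afterDuel β s (m + 1) = ⟨s, m + 1, Phase.explore⟩ := by
  unfold afterDuel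
  rw [dif_neg (h.not_roundWonBy hy hy')]

theorem afterDuel_of_iterationStart (h : IterationStart s m F i)
    (hF : F.card + 1 < Fintype.card A) :
    afterDuel β s (m + 1) = ⟨s, m + 1, Phase.explore⟩ := by
  unfold afterDuel
  rw [dif_neg (h.not_roundWonBy hF)]

theorem afterDuel_of_last [Nontrivial A] (h : IterationStart s m F i)
    (hF : F.card + 1 = Fintype.card A) :
    afterDuel β s (m + 1) = exploiting s (m + 1) i ⌊β ^ (m + 1)⌋₊ := by
  have hex : ∃ z, s.RoundWonBy (m + 1) z := ⟨i, h.roundWonBy hF⟩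
  unfold afterDuel
  rw [dif_pos hex, h.eq_of_roundWonBy hF hex.choose_spec]

end WSS

end DuelingBandits

/-! ### Potentials for the gambler's ruin of one iteration. -/

namespace DuelingBandits

/-- A bound on the expected number of duels until a random walk on `{0, …, n}` that goes up with
probability `q` and down with probability `1 - q` reaches `0` or `n`, in terms of its position:
`f` decreases by at least one in each step, on average. -/
structure DuelPotential (q : ℝ) (n : ℕ) (f : ℕ → ℝ) : Prop where
  nonneg : ∀ y ≤ n, 0 ≤ f y
  step : ∀ y, y + 2 ≤ n → 1 + q * f (y + 2) + (1 - q) * f y ≤ f (y + 1)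

namespace DuelPotential

variable {q : ℝ} {n : ℕ} {f : ℕ → ℝ}

theorem swap (h : DuelPotential q n f) : DuelPotential (1 - q) n fun y => f (n - y) where
  nonneg := fun y _ => h.nonneg _ (Nat.sub_le _ _)
  step := fun y hy => by
    obtain ⟨k, rfl⟩ := Nat.exists_eq_add_of_le hy
    have := h.step k (by omega)
    have h1 : y + 2 + k - (y + 2) = k := by omega
    have h2 : y + 2 + k - y = k + 2 := by omega
    have h3 : y + 2 + k - (y + 1) = k + 1 := by omega
    simp only [h1, h2, h3]
    linarith

/-- Distance to the top divided by a lower bound for the upward drift; absorption at 0 is ignored.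
-/
theorem linear {d : ℝ} (hd : 0 < d) (hq : d ≤ 2 * q - 1) (n : ℕ) :
    DuelPotential q n fun y => ((n : ℝ) - y) / d where
  nonneg := fun y hy => by
    have : (y : ℝ) ≤ n := by exact_mod_cast hy
    exact div_nonneg (by linarith) hd.le
  step := fun y _ => by
    have e : ((n : ℝ) - (y + 1 : ℕ)) / d -
        (1 + q * (((n : ℝ) - (y + 2 : ℕ)) / d) + (1 - q) * (((n : ℝ) - y) / d)) =
        (2 * q - 1 - d) / d := by
      push_cast
      field_simp
      ring
    have : 0 ≤ (2 * q - 1 - d) / d := div_nonneg (by linarith) hd.le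
    linarith

theorem symmetric (n : ℕ) : DuelPotential (1 / 2) n fun y => (y : ℝ) * (n - y) where
  nonneg := fun y hy => by
    have : (y : ℝ) ≤ n := by exact_mod_cast hy
    exact mul_nonneg (Nat.cast_nonneg y) (by linarith)
  step := fun y _ => by
    push_cast
    linarith

/-- A supersolution vanishing at both ends, simpler than the exact duration. The step inequality has
slack ρ^(y+1), where ρ = (1-q)/q. -/
theorem biased (hq : 1 / 2 < q) (hq1 : q ≤ 1) (n : ℕ) :
    DuelPotential q n fun y => ((n : ℝ) - y) * (1 - ((1 - q) / q) ^ y) / (2 * q - 1) where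
  nonneg := fun y hy => by
    have h1 : (y : ℝ) ≤ n := by exact_mod_cast hy
    have h2 : ((1 - q) / q) ^ y ≤ 1 :=
      pow_le_one₀ (div_nonneg (by linarith) (by linarith))
        ((div_le_one (by linarith)).2 (by linarith))
    exact div_nonneg (mul_nonneg (by linarith) (by linarith)) (by linarith)
  step := fun y _ => by
    obtain ⟨ρ, hρ⟩ : ∃ ρ, ρ = (1 - q) / q := ⟨_, rfl⟩
    have hq0 : q ≠ 0 := by linarith
    have hqρ : 1 - q = q * ρ := by rw [hρ]; field_simp
    have hd : 0 < 2 * q - 1 := by linarith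
    have hρ0 : 0 ≤ ρ := hρ ▸ div_nonneg (by linarith) (by linarith)
    simp only [← hρ]
    have e : ((n : ℝ) - (y + 1 : ℕ)) * (1 - ρ ^ (y + 1)) / (2 * q - 1) -
        (1 + q * (((n : ℝ) - (y + 2 : ℕ)) * (1 - ρ ^ (y + 2)) / (2 * q - 1)) +
          (1 - q) * (((n : ℝ) - y) * (1 - ρ ^ y) / (2 * q - 1))) = ρ ^ (y + 1) := by
      have hq' : q * (1 + ρ) = 1 := by linarith
      have hd' : 2 * q - 1 = q * (1 - ρ) := by linarith
      have h1 : (1 - ρ) ≠ 0 := fun h => by rw [hd', h] at hd; simp at hd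
      rw [hd', hqρ]
      push_cast
      field_simp
      have hq2 : q = 1 / (1 + ρ) := by
        rw [eq_div_iff (by linarith)]; exact hq'
      rw [hq2]
      field_simp
      ring
    have := pow_nonneg hρ0 (y + 1)
    linarith

end DuelPotential

/-- A bound on the duration of a duel between two arms one of which has to win by `a`, where no
preference probability is in `(1 - p, p)`, apart from `1 / 2`. -/
theorem exists_duelPotential {p q : ℝ} (hp : 1 / 2 < p) (hp1 : p ≤ 1) (hq0 : 0 ≤ q)
    (hq : q = 1 / 2 ∨ q ≤ 1 - p) (a : ℕ) :
    ∃ f, DuelPotential q (a + 1) f ∧ f a ≤ a / p := by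
  have ha : (0 : ℝ) ≤ a := Nat.cast_nonneg a
  rcases hq with rfl | hq
  · refine ⟨_, DuelPotential.symmetric (a + 1), ?_⟩
    rw [le_div_iff₀ (by linarith)]
    push_cast
    nlinarith
  -- With downward drift the walk is reflected: the start `a` becomes 1, where the potential equals
  -- a / (1 - q).
  · have h := (DuelPotential.biased (q := 1 - q) (by linarith) (by linarith) (a + 1)).swap
    rw [sub_sub_cancel] at h
    refine ⟨_, h, ?_⟩
    have h1 : a + 1 - a = 1 := by omega
    simp only [h1, pow_one]
    have hd : 2 * (1 - q) - 1 ≠ 0 := by linarith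
    have e : (((a + 1 : ℕ) : ℝ) - (1 : ℕ)) * (1 - q / (1 - q)) / (2 * (1 - q) - 1) =
        a / (1 - q) := by
      have h2 : 1 - q ≠ 0 := by linarith
      rw [div_eq_div_iff hd h2]
      push_cast
      field_simp
      ring
    rw [e]
    exact div_le_div_of_nonneg_left ha (by linarith) (by linarith)

/-! ### Cost functions, affine in the weight of the best arm. -/

/-- An affine function with nonnegative coefficients. -/
def IsNonnegAffine (g : ℝ → ℝ) : Prop :=
  ∃ a b : ℝ, 0 ≤ a ∧ 0 ≤ b ∧ ∀ x, g x = a + b * x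

namespace IsNonnegAffine

theorem add {g h : ℝ → ℝ} (hg : IsNonnegAffine g) (hh : IsNonnegAffine h) :
    IsNonnegAffine fun x => g x + h x := by
  obtain ⟨a, b, ha, hb, h1⟩ := hg
  obtain ⟨a', b', ha', hb', h2⟩ := hh
  refine ⟨a + a', b + b', add_nonneg ha ha', add_nonneg hb hb', fun x => ?_⟩
  simp only [h1, h2]
  ring

theorem sum {ι : Type*} (S : Finset ι) {g : ι → ℝ → ℝ} (hg : ∀ k, IsNonnegAffine (g k)) :
    IsNonnegAffine fun x => ∑ k ∈ S, g k x := by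
  choose a b ha hb h using hg
  refine ⟨∑ k ∈ S, a k, ∑ k ∈ S, b k, Finset.sum_nonneg fun k _ => ha k,
    Finset.sum_nonneg fun k _ => hb k, fun x => ?_⟩
  rw [Finset.sum_mul, ← Finset.sum_add_distrib]
  exact Finset.sum_congr rfl fun k _ => h k x

theorem nonneg {g : ℝ → ℝ} (hg : IsNonnegAffine g) {x : ℝ} (hx : 0 ≤ x) : 0 ≤ g x := by
  obtain ⟨a, b, ha, hb, h⟩ := hg
  rw [h]
  positivity

/-- This is how the supermartingale inequality passes through every cost function. -/
theorem average_le {g : ℝ → ℝ} (hg : IsNonnegAffine g) {q x y z : ℝ}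
    (h : q * x + (1 - q) * y ≤ z) : q * g x + (1 - q) * g y ≤ g z := by
  obtain ⟨a, b, _, hb, hg⟩ := hg
  rw [hg, hg, hg]
  nlinarith [mul_le_mul_of_nonneg_left h hb]

end IsNonnegAffine

/-- A bound on the expected number of duels in an iteration of round `m + 1` that starts after `c`
other iterations; `x` is the value of `((1 - p) / p) ^ C w` for the best arm `w`. -/
def iterationCost (p : ℝ) (N m c : ℕ) (x : ℝ) : ℝ :=
  1 / (2 * p - 1) + ((1 - p) / p) ^ m * x * ((N : ℝ) * m + c + 1) / p

/-- A bound on the expected strong regret in round `m + 1`. -/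
def roundCost (p β : ℝ) (N m : ℕ) (x : ℝ) : ℝ :=
  ∑ c ∈ Finset.range (N - 1), iterationCost p N m c x + (β * ((1 - p) / p)) ^ (m + 1) * x

/-- A bound on the expected strong regret in the rounds `m + 1, …, M`. -/
def roundsCost (p β : ℝ) (N M m : ℕ) (x : ℝ) : ℝ :=
  ∑ k ∈ Finset.Ico m M, roundCost p β N k x

/-- A bound on the expected strong regret up to round `M` when `c` iterations of round `m + 1`
are over. -/
def remainingCost (p β : ℝ) (N M m c : ℕ) (x : ℝ) : ℝ :=
  ∑ k ∈ Finset.Ico c (N - 1), iterationCost p N m k x + (β * ((1 - p) / p)) ^ (m + 1) * x +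
    roundsCost p β N M (m + 1) x

theorem isNonnegAffine_iterationCost {p : ℝ} (hp : 1 / 2 < p) (hp1 : p ≤ 1) (N m c : ℕ) :
    IsNonnegAffine (iterationCost p N m c) := by
  have hr : 0 ≤ (1 - p) / p := div_nonneg (by linarith) (by linarith)
  have hd : 0 < 2 * p - 1 := by linarith
  have hp0 : 0 < p := by linarith
  refine ⟨1 / (2 * p - 1), ((1 - p) / p) ^ m * ((N : ℝ) * m + c + 1) / p, by positivity,
    by positivity, fun x => ?_⟩
  unfold iterationCost
  ring

theorem isNonnegAffine_pow_mul {p β : ℝ} (hp : 1 / 2 < p) (hp1 : p ≤ 1) (hβ : 0 ≤ β) (m : ℕ) :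
    IsNonnegAffine fun x => (β * ((1 - p) / p)) ^ (m + 1) * x := by
  have hr : 0 ≤ (1 - p) / p := div_nonneg (by linarith) (by linarith)
  exact ⟨0, _, le_rfl, by positivity, fun x => (zero_add _).symm⟩

theorem isNonnegAffine_roundCost {p β : ℝ} (hp : 1 / 2 < p) (hp1 : p ≤ 1) (hβ : 0 ≤ β)
    (N m : ℕ) : IsNonnegAffine (roundCost p β N m) :=
  (IsNonnegAffine.sum _ fun c => isNonnegAffine_iterationCost hp hp1 N m c).add
    (isNonnegAffine_pow_mul hp hp1 hβ m)

theorem isNonnegAffine_roundsCost {p β : ℝ} (hp : 1 / 2 < p) (hp1 : p ≤ 1) (hβ : 0 ≤ β)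
    (N M m : ℕ) : IsNonnegAffine (roundsCost p β N M m) :=
  IsNonnegAffine.sum _ fun m => isNonnegAffine_roundCost hp hp1 hβ N m

theorem isNonnegAffine_remainingCost {p β : ℝ} (hp : 1 / 2 < p) (hp1 : p ≤ 1) (hβ : 0 ≤ β)
    (N M m c : ℕ) : IsNonnegAffine (remainingCost p β N M m c) :=
  ((IsNonnegAffine.sum _ fun c => isNonnegAffine_iterationCost hp hp1 N m c).add
    (isNonnegAffine_pow_mul hp hp1 hβ m)).add (isNonnegAffine_roundsCost hp hp1 hβ N M (m + 1))


theorem remainingCost_of_lt (p β : ℝ) {N c : ℕ} (M m : ℕ) (hc : c + 1 < N) (x : ℝ) :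
    remainingCost p β N M m c x = iterationCost p N m c x + remainingCost p β N M m (c + 1) x := by
  unfold remainingCost
  rw [Finset.sum_eq_sum_Ico_succ_bot (by omega)]
  ring

theorem remainingCost_last (p β : ℝ) {N c : ℕ} (M m : ℕ) (hc : c + 1 = N) (x : ℝ) :
    remainingCost p β N M m c x =
      (β * ((1 - p) / p)) ^ (m + 1) * x + roundsCost p β N M (m + 1) x := by
  unfold remainingCost
  rw [Finset.Ico_eq_empty (by omega), Finset.sum_empty, zero_add]

theorem roundsCost_of_lt (p β : ℝ) (N : ℕ) {M m : ℕ} (hm : m < M) (x : ℝ) :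
    roundsCost p β N M m x = remainingCost p β N M m 0 x := by
  unfold remainingCost roundsCost
  rw [Finset.sum_eq_sum_Ico_succ_bot hm, roundCost, Nat.Ico_zero_eq_range]

/-- The least number of time periods that the first `m` rounds of WS-S take with `N` arms. -/
def roundTime (β : ℝ) (N m : ℕ) : ℕ :=
  ∑ k ∈ Finset.range m, (⌊β ^ (k + 1)⌋₊ + (N - 1))

/-- The supermartingale step of the score of the best arm. -/
theorem zpow_average_le {p q : ℝ} (hp : 1 / 2 < p) (hp1 : p < 1) (hq : p ≤ q) (C : ℤ) :
    q * ((1 - p) / p) ^ (C + 1) + (1 - q) * ((1 - p) / p) ^ (C - 1) ≤ ((1 - p) / p) ^ C := by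
  have hp0 : 0 < p := by linarith
  have hp2 : 0 < 1 - p := by linarith
  have hr : 0 < (1 - p) / p := div_pos hp2 hp0
  rw [zpow_add_one₀ hr.ne', zpow_sub_one₀ hr.ne']
  have hz : 0 < ((1 - p) / p) ^ C := zpow_pos hr C
  have e : ((1 - p) / p) ^ C - (q * (((1 - p) / p) ^ C * ((1 - p) / p)) +
      (1 - q) * (((1 - p) / p) ^ C * ((1 - p) / p)⁻¹)) =
      ((1 - p) / p) ^ C * ((q - p) * (2 * p - 1) / (p * (1 - p))) := by
    generalize ((1 - p) / p) ^ C = z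
    field_simp
    ring
  have : 0 ≤ (q - p) * (2 * p - 1) / (p * (1 - p)) :=
    div_nonneg (mul_nonneg (by linarith) (by linarith)) (by positivity)
  have := mul_nonneg hz.le this
  linarith

end DuelingBandits

/-! ### Regret bounds by induction on the number of periods left. -/

namespace DuelingBandits

theorem strongRegret_le_one {A : Type u} [DecidableEq A] (w : A) (a : A × A) :
    strongRegret w a ≤ 1 := by
  unfold strongRegret
  split_ifs <;> simp

variable {A : Type u} [DecidableEq A] [Fintype A]

/-- Arm `w` beats every other arm with probability at least `p`, and no preference probability is
in `(1 - p, p)`, apart from `1 / 2`. -/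
structure Preferences.HasGap {A : Type u} (P : Preferences A) (w : A) (p : ℝ) : Prop where
  best : ∀ i, i ≠ w → p ≤ P.prob w i
  gap : ∀ i j, p ≤ P.prob i j ∨ P.prob i j = 1 / 2 ∨ P.prob i j ≤ 1 - p

/-- The supermartingale that controls the score of the best arm `w`. -/
def WSW.weight (p : ℝ) (w : A) (s : WSW A) : ℝ :=
  ((1 - p) / p) ^ s.score w

namespace WSW

theorem weight_pos {p : ℝ} (hp : 1 / 2 < p) (hp1 : p < 1) (w : A) (s : WSW A) :
    0 < s.weight p w :=
  zpow_pos (div_pos (by linarith) (by linarith)) _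

theorem weight_record_average_le {P : Preferences A} {w : A} {p : ℝ} (hP : P.HasGap w p)
    (hp : 1 / 2 < p) (hp1 : p < 1) (s : WSW A) {i j : A} (hij : i ≠ j) :
    P.prob i j * (s.record i j true).weight p w +
      (1 - P.prob i j) * (s.record i j false).weight p w ≤ s.weight p w := by
  unfold weight
  rw [score_record s hij, score_record s hij]
  by_cases hi : w = i
  · subst hi
    have := zpow_average_le hp hp1 (hP.best j hij.symm) (s.score w)
    simpa [hij, sub_eq_add_neg] using this
  · by_cases hj : w = j
    · subst hj
      have := zpow_average_le hp hp1 (hP.best i hij) (s.score w)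
      have h1 : P.prob i w = 1 - P.prob w i := by linarith [P.prob_add_swap i w]
      rw [h1, sub_sub_cancel, add_comm]
      simpa [hi, sub_eq_add_neg] using this
    · simp only [hi, hj, if_true, if_false, Bool.false_eq_true, sub_self, add_zero]
      linarith

/-- Replaces the indicator of the bad event "C(w) ≤ -m" by a multiple of the supermartingale. -/
theorem one_le_pow_mul_weight {p : ℝ} (hp : 1 / 2 < p) (hp1 : p < 1) {w : A} {s : WSW A} {m : ℕ}
    (h : s.score w ≤ -(m : ℤ)) : 1 ≤ ((1 - p) / p) ^ m * s.weight p w := by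
  have hr : 0 < (1 - p) / p := div_pos (by linarith) (by linarith)
  have hr1 : (1 - p) / p ≤ 1 := (div_le_one (by linarith)).2 (by linarith)
  unfold weight
  rw [← zpow_natCast, ← zpow_add₀ hr.ne']
  exact one_le_zpow_of_nonpos₀ hr hr1 (by omega)

end WSW

namespace WSS

open WSW

variable [Nontrivial A]

theorem futureRegret_explore_le (P : Preferences A) (β : ℝ) (w : A) (n ℓ : ℕ) (s : WSW A)
    {c : ℝ≥0∞}
    (h : ∀ a ∈ s.choosePair.support,
      1 + (ENNReal.ofReal (P.prob a.1 a.2) *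
          futureRegret P β w n (afterDuel β (s.record a.1 a.2 true) ℓ) +
        ENNReal.ofReal (P.prob a.2 a.1) *
          futureRegret P β w n (afterDuel β (s.record a.1 a.2 false) ℓ)) ≤ c) :
    futureRegret P β w (n + 1) ⟨s, ℓ, Phase.explore⟩ ≤ c := by
  rw [futureRegret, step]
  simp only
  rw [PMF.expect_map, WSW.step, PMF.expect_bind]
  refine PMF.expect_le_of_support _ fun a ha => ?_
  rw [PMF.expect_map]
  simp only
  rw [PMF.expect_const_add, Preferences.expect_duel]
  refine le_trans (add_le_add ?_ le_rfl) (h a ha)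
  exact_mod_cast strongRegret_le_one w a

theorem futureRegret_exploit (P : Preferences A) (β : ℝ) (w : A) (n ℓ k : ℕ) (s : WSW A) (z : A) :
    futureRegret P β w (n + 1) (exploiting s ℓ z (k + 1)) =
      (if z = w then 0 else 1) + futureRegret P β w n (exploiting s ℓ z k) := by
  rw [futureRegret]
  simp only [exploiting, step]
  rw [PMF.expect_pure]
  congr 1
  unfold strongRegret
  split_ifs <;> simp_all

/-- The parameters of the regret analysis: rounds after round `M` do not start within the first
`T` time periods. -/
structure Horizon (P : Preferences A) (β : ℝ) (w : A) (p : ℝ) (T M : ℕ) : Prop where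
  gap : P.HasGap w p
  half_lt : 1 / 2 < p
  lt_one : p < 1
  nonneg : 0 ≤ β
  lt_of_le : ∀ m, roundTime β (Fintype.card A) m + 1 ≤ T → m < M

/-- The regret bound in the middle of an iteration, when `n` time periods are left. -/
def DuelBound (P : Preferences A) (β : ℝ) (w : A) (p : ℝ) (T M n : ℕ) : Prop :=
  ∀ (s : WSW A) (m : ℕ) (F : Finset A) (i j : A) (y : ℕ) (f : ℕ → ℝ), Dueling s m F i j y →
    0 < y → y < Fintype.card A * m + F.card + 2 → s.last = some (i, j) →
    DuelPotential (P.prob i j) (Fintype.card A * m + F.card + 2) f →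
    roundTime β (Fintype.card A) m + F.card + n ≤ T →
    futureRegret P β w n ⟨s, m + 1, Phase.explore⟩ ≤ ENNReal.ofReal
      (f y + remainingCost p β (Fintype.card A) M m (F.card + 1) (s.weight p w))

/-- The regret bound at the start of an iteration, when `n` time periods are left. -/
def IterationBound (P : Preferences A) (β : ℝ) (w : A) (p : ℝ) (T M n : ℕ) : Prop :=
  ∀ (s : WSW A) (m : ℕ) (F : Finset A) (i : A), IterationStart s m F i →
    F.card + 1 < Fintype.card A → roundTime β (Fintype.card A) m + F.card + n ≤ T →
    futureRegret P β w n ⟨s, m + 1, Phase.explore⟩ ≤ ENNReal.ofReal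
      (remainingCost p β (Fintype.card A) M m F.card (s.weight p w))

/-- The regret bound in the exploitation phase, when `n` time periods are left. -/
def ExploitBound (P : Preferences A) (β : ℝ) (w : A) (p : ℝ) (T M n : ℕ) : Prop :=
  ∀ (s : WSW A) (m k : ℕ) (i : A), IterationStart s (m + 1) ∅ i →
    roundTime β (Fintype.card A) (m + 1) + n ≤ T + k →
    futureRegret P β w n (exploiting s (m + 1) i k) ≤ ENNReal.ofReal
      (k * (if i = w then 0 else 1) + roundsCost p β (Fintype.card A) M (m + 1) (s.weight p w))

variable {P : Preferences A} {β : ℝ} {w : A} {p : ℝ} {T M n : ℕ}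

theorem futureRegret_afterDuel_of_iterationStart (H : Horizon P β w p T M)
    (hS : IterationBound P β w p T M n) (hE : ExploitBound P β w p T M n)
    {s : WSW A} {m : ℕ} {F : Finset A} {i : A} (h : IterationStart s m F i)
    (ht : roundTime β (Fintype.card A) m + F.card + n ≤ T) :
    futureRegret P β w n (afterDuel β s (m + 1)) ≤ ENNReal.ofReal
      (remainingCost p β (Fintype.card A) M m F.card (s.weight p w)) := by
  rcases h.card_lt.lt_or_eq with hF | hF
  · rw [afterDuel_of_iterationStart β h hF]
    exact hS s m F i h hF ht
  · rw [afterDuel_of_last β h hF]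
    refine (hE s m _ i (h.next_round hF) ?_).trans (ENNReal.ofReal_le_ofReal ?_)
    -- The round has used at least N-1 periods, one per loser; its exploitation periods are all
    -- still to come and are accounted for by `k`.
    · rw [roundTime, Finset.sum_range_succ, ← roundTime]
      omega
    · rw [remainingCost_last p β M m hF]
      refine add_le_add ?_ le_rfl
      have hβ := pow_nonneg H.nonneg (m + 1)
      split_ifs with hi
      · have h1 := weight_pos H.half_lt H.lt_one w s
        have h2 : 0 ≤ (1 - p) / p :=
          div_nonneg (by linarith [H.lt_one]) (by linarith [H.half_lt])
        rw [mul_zero]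
        exact mul_nonneg (pow_nonneg (mul_nonneg H.nonneg h2) _) h1.le
      -- A wrong winner leaves `w` among the losers, at score -(m+1).
      · have h1 : 1 ≤ ((1 - p) / p) ^ (m + 1) * s.weight p w := by
          refine one_le_pow_mul_weight H.half_lt H.lt_one ?_
          rw [h.score_of_last hF (Ne.symm hi)]
          push_cast
          rfl
        rw [mul_one, mul_pow, mul_assoc]
        exact (Nat.floor_le hβ).trans (le_mul_of_one_le_right hβ h1)

/-- After a duel the iteration is lost by `i` (y = 0), lost by `j` (y maximal), or still running.
The period spent on the duel, the `n + 1` in `ht`, pays for the growth of `F` by one loser. -/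
theorem futureRegret_afterDuel_of_dueling (H : Horizon P β w p T M)
    (hD : DuelBound P β w p T M n) (hS : IterationBound P β w p T M n)
    (hE : ExploitBound P β w p T M n)
    {s : WSW A} {m : ℕ} {F : Finset A} {i j : A} {y : ℕ} {f : ℕ → ℝ} (h : Dueling s m F i j y)
    (hl : s.last = some (i, j))
    (hf : DuelPotential (P.prob i j) (Fintype.card A * m + F.card + 2) f)
    (ht : roundTime β (Fintype.card A) m + F.card + (n + 1) ≤ T) :
    futureRegret P β w n (afterDuel β s (m + 1)) ≤ ENNReal.ofReal
      (f y + remainingCost p β (Fintype.card A) M m (F.card + 1) (s.weight p w)) := by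
  have hfy := hf.nonneg y h.le
  rcases Nat.eq_zero_or_pos y with rfl | hy
  · have h' := h.iterationStart
    have hc := Finset.card_insert_of_notMem h.notMem_left
    have := futureRegret_afterDuel_of_iterationStart H hS hE h' (by omega)
    rw [hc] at this
    exact this.trans (ENNReal.ofReal_le_ofReal (by linarith))
  · rcases h.le.lt_or_eq with hy' | hy'
    · rw [afterDuel_of_dueling β h hy hy']
      exact hD s m F i j y f h hy hy' hl hf (by omega)
    · have h' := h.swap
      rw [hy', Nat.sub_self] at h'
      have hc := Finset.card_insert_of_notMem h.notMem_right
      have := futureRegret_afterDuel_of_iterationStart H hS hE h'.iterationStart (by omega)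
      rw [hc] at this
      exact this.trans (ENNReal.ofReal_le_ofReal (by linarith))

/-- The expected drop of the potential pays for the duel, while the later costs do not increase on
average. -/
theorem duel_average_le (H : Horizon P β w p T M)
    (hD : DuelBound P β w p T M n) (hS : IterationBound P β w p T M n)
    (hE : ExploitBound P β w p T M n)
    {s : WSW A} {m : ℕ} {F : Finset A} {i j : A} {y : ℕ} {f : ℕ → ℝ} (h : Dueling s m F i j y)
    (hy : 0 < y) (hy' : y < Fintype.card A * m + F.card + 2)
    (hf : DuelPotential (P.prob i j) (Fintype.card A * m + F.card + 2) f)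
    (ht : roundTime β (Fintype.card A) m + F.card + (n + 1) ≤ T) :
    1 + (ENNReal.ofReal (P.prob i j) *
          futureRegret P β w n (afterDuel β (s.record i j true) (m + 1)) +
        ENNReal.ofReal (P.prob j i) *
          futureRegret P β w n (afterDuel β (s.record i j false) (m + 1))) ≤
      ENNReal.ofReal
        (f y + remainingCost p β (Fintype.card A) M m (F.card + 1) (s.weight p w)) := by
  obtain ⟨z, rfl⟩ := Nat.exists_eq_succ_of_ne_zero hy.ne'
  rw [Nat.succ_eq_add_one] at *
  have h1 := h.record_true hy'
  have h0 := h.record_false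
  have b1 := futureRegret_afterDuel_of_dueling H hD hS hE h1 rfl hf ht
  have b0 := futureRegret_afterDuel_of_dueling H hD hS hE h0 rfl hf ht
  have hG := isNonnegAffine_remainingCost H.half_lt H.lt_one.le H.nonneg (Fintype.card A) M m
    (F.card + 1)
  have hw := hG.average_le (weight_record_average_le H.gap H.half_lt H.lt_one s h.ne)
  have hs := hf.step z (by omega)
  have hq : P.prob j i = 1 - P.prob i j := by linarith [P.prob_add_swap i j]
  have hq0 := P.prob_nonneg i j
  have hq1 := P.prob_nonneg j i
  have n1 := hG.nonneg (weight_pos H.half_lt H.lt_one w (s.record i j true)).le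
  have n0 := hG.nonneg (weight_pos H.half_lt H.lt_one w (s.record i j false)).le
  have m1 := hf.nonneg _ h1.le
  have m0 := hf.nonneg _ h0.le
  refine (add_le_add le_rfl (add_le_add (mul_le_mul_right b1 _)
    (mul_le_mul_right b0 _))).trans ?_
  rw [← ENNReal.ofReal_mul hq0, ← ENNReal.ofReal_mul hq1, ← ENNReal.ofReal_one,
    ← ENNReal.ofReal_add (mul_nonneg hq0 (by linarith)) (mul_nonneg hq1 (by linarith)),
    ← ENNReal.ofReal_add zero_le_one (add_nonneg (mul_nonneg hq0 (by linarith))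
      (mul_nonneg hq1 (by linarith)))]
  refine ENNReal.ofReal_le_ofReal ?_
  rw [hq]
  have e : z + 1 + 1 = z + 2 := rfl
  rw [e]
  nlinarith

theorem DuelBound.succ (H : Horizon P β w p T M)
    (hD : DuelBound P β w p T M n) (hS : IterationBound P β w p T M n)
    (hE : ExploitBound P β w p T M n) : DuelBound P β w p T M (n + 1) := by
  intro s m F i j y f h hy hy' hl hf ht
  refine futureRegret_explore_le P β w n (m + 1) s fun a ha => ?_
  rcases h.mem_support_choosePair hy hy' hl ha with rfl | rfl
  · exact duel_average_le H hD hS hE h hy hy' hf ht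
  · have hf' := hf.swap
    have hq : 1 - P.prob i j = P.prob j i := by linarith [P.prob_add_swap i j]
    rw [hq] at hf'
    have := duel_average_le H hD hS hE h.swap (by omega) (by omega) hf' ht
    rwa [Nat.sub_sub_self h.le] at this

theorem exists_duelPotential_le_iterationCost (H : Horizon P β w p T M)
    {s : WSW A} {m : ℕ} {F : Finset A} {i : A} (h : IterationStart s m F i) (j : A) (hj : j ≠ i) :
    ∃ f, DuelPotential (P.prob i j) (Fintype.card A * m + F.card + 2) f ∧
      f (Fintype.card A * m + F.card + 1) ≤
        iterationCost p (Fintype.card A) m F.card (s.weight p w) := by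
  have hp := H.half_lt
  have hp1 := H.lt_one
  have hd : 0 < 2 * p - 1 := by linarith
  have hr : 0 < (1 - p) / p := div_pos (by linarith) (by linarith)
  have hX := weight_pos hp hp1 w s
  have hp0 : 0 < p := by linarith
  unfold iterationCost
  by_cases hq : p ≤ P.prob i j
  · refine ⟨_, DuelPotential.linear hd (q := P.prob i j) (by linarith) _, ?_⟩
    have e : ((Fintype.card A * m + F.card + 2 : ℕ) : ℝ) -
        (Fintype.card A * m + F.card + 1 : ℕ) = 1 := by
      push_cast
      ring
    rw [e]
    exact le_add_of_nonneg_right (by positivity)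
  -- An incumbent that is not favoured is not `w`, so `w` is a loser or fresh and its weight pays
  -- for the long iteration.
  · have hiw : i ≠ w := fun e => hq (e ▸ H.gap.best j (e ▸ hj))
    obtain ⟨f, hf, hfa⟩ := exists_duelPotential hp hp1.le (P.prob_nonneg i j)
      ((H.gap.gap i j).resolve_left hq) (Fintype.card A * m + F.card + 1)
    refine ⟨f, hf, hfa.trans ?_⟩
    have hw : s.score w ≤ -(m : ℤ) := by
      by_cases hwF : w ∈ F
      · rw [h.score_loser w hwF]
        omega
      · rw [h.score_fresh w hwF hiw.symm]
    have h1 := one_le_pow_mul_weight hp hp1 hw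
    have h2 : 0 ≤ 1 / (2 * p - 1) := by positivity
    have h3 : ((Fintype.card A * m + F.card + 1 : ℕ) : ℝ) / p ≤
        ((1 - p) / p) ^ m * s.weight p w * ((Fintype.card A : ℝ) * m + F.card + 1) / p := by
      refine div_le_div_of_nonneg_right ?_ hp0.le
      push_cast
      exact le_mul_of_one_le_left (by positivity) h1
    linarith

theorem IterationBound.succ (H : Horizon P β w p T M)
    (hD : DuelBound P β w p T M n) (hS : IterationBound P β w p T M n)
    (hE : ExploitBound P β w p T M n) : IterationBound P β w p T M (n + 1) := by
  intro s m F i h hF ht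
  refine futureRegret_explore_le P β w n (m + 1) s fun a ha => ?_
  obtain ⟨h1, h2⟩ := mem_support_choosePair ha
  have h' := h.of_mem_argmax hF h1
  have hd := h'.dueling hF h2
  obtain ⟨f, hf, hfle⟩ := exists_duelPotential_le_iterationCost H h' a.2 hd.ne.symm
  refine (duel_average_le H hD hS hE hd (by omega) (by omega) hf ht).trans
    (ENNReal.ofReal_le_ofReal ?_)
  rw [remainingCost_of_lt p β M m hF]
  linarith

theorem IterationBound.roundStart (H : Horizon P β w p T M) (hS : IterationBound P β w p T M n)
    {s : WSW A} {m : ℕ} {i : A} (h : IterationStart s m ∅ i)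
    (ht : roundTime β (Fintype.card A) m + n ≤ T) :
    futureRegret P β w n ⟨s, m + 1, Phase.explore⟩ ≤ ENNReal.ofReal
      (roundsCost p β (Fintype.card A) M m (s.weight p w)) := by
  rcases Nat.eq_zero_or_pos n with rfl | hn
  · simp [futureRegret]
  · rw [roundsCost_of_lt p β _ (H.lt_of_le m (by omega))]
    have := hS s m ∅ i h (by simpa using Fintype.one_lt_card (α := A)) (by simpa using ht)
    simpa using this

theorem ExploitBound.succ (H : Horizon P β w p T M)
    (hS : IterationBound P β w p T M (n + 1))
    (hE : ExploitBound P β w p T M n) : ExploitBound P β w p T M (n + 1) := by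
  intro s m k i h ht
  cases k with
  | zero =>
    have := hS.roundStart H h (by simpa using ht)
    simpa [exploiting] using this
  | succ k =>
    rw [futureRegret_exploit]
    refine (add_le_add le_rfl (hE s m k i h (by omega))).trans ?_
    have hG := (isNonnegAffine_roundsCost H.half_lt H.lt_one.le H.nonneg (Fintype.card A) M
      (m + 1)).nonneg (weight_pos H.half_lt H.lt_one w s).le
    split_ifs with hi
    · simp
    · rw [← ENNReal.ofReal_one, ← ENNReal.ofReal_add zero_le_one (by positivity)]
      refine ENNReal.ofReal_le_ofReal ?_
      push_cast
      linarith

theorem bounds (H : Horizon P β w p T M) (n : ℕ) :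
    DuelBound P β w p T M n ∧ IterationBound P β w p T M n ∧ ExploitBound P β w p T M n := by
  induction n with
  | zero =>
    refine ⟨?_, ?_, ?_⟩ <;> intro <;> intros <;> simp [futureRegret]
  | succ n ih =>
    obtain ⟨hD, hS, hE⟩ := ih
    -- An exploitation phase with no periods left is already the next round, with no time elapsed;
    -- hence its bound at `n + 1` needs the iteration bound at `n + 1`.
    have hS' := hS.succ H hD hE
    exact ⟨hD.succ H hS hE, hS', hE.succ H hS'⟩

theorem expectedStrongRegret_le_roundsCost (H : Horizon P β w p T M) :
    expectedStrongRegret P β w T ≤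
      ENNReal.ofReal (roundsCost p β (Fintype.card A) M 0 1) := by
  rw [expectedStrongRegret_eq_futureRegret]
  -- With all scores zero, any arm can serve as the first incumbent.
  have := (bounds H T).2.1.roundStart H (iterationStart_init w) (by simp [roundTime])
  have hw : (WSW.init A).weight p w = 1 := by simp [weight, score, WSW.init]
  rwa [hw] at this

end WSS

end DuelingBandits

/-! ### Closed forms, the number of rounds, and the numerical estimates. -/

namespace DuelingBandits

open Filter Topology

/-- A closed form that dominates `roundsCost p β N M 0 1`. -/
def explicitCost (p β : ℝ) (N M : ℕ) : ℝ :=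
  M * ((N : ℝ) - 1) / (2 * p - 1) + N * ((N : ℝ) - 1) / (2 * (2 * p - 1) ^ 2) +
    ∑ k ∈ Finset.range M, (β * ((1 - p) / p)) ^ (k + 1)

/-- The right side is the sum of the whole series; the proof exhibits the tail explicitly. -/
theorem sum_pow_mul_add_half_le {r : ℝ} (hr : 0 ≤ r) (hr1 : r < 1) (M : ℕ) :
    ∑ m ∈ Finset.range M, r ^ m * ((m : ℝ) + 1 / 2) ≤ (1 + r) / (2 * (1 - r) ^ 2) := by
  have h1 : 0 < 1 - r := by linarith
  have e : ∑ m ∈ Finset.range M, r ^ m * ((m : ℝ) + 1 / 2) +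
      r ^ M * (M / (1 - r) + (1 + r) / (2 * (1 - r) ^ 2)) = (1 + r) / (2 * (1 - r) ^ 2) := by
    induction M with
    | zero => simp
    | succ M ih =>
      have h2 : r ^ M * ((M : ℝ) + 1 / 2) +
          r ^ (M + 1) * ((M + 1 : ℕ) / (1 - r) + (1 + r) / (2 * (1 - r) ^ 2)) =
          r ^ M * (M / (1 - r) + (1 + r) / (2 * (1 - r) ^ 2)) := by
        rw [pow_succ]
        push_cast
        field_simp
        ring
      rw [Finset.sum_range_succ, add_assoc, h2, ih]
  have : 0 ≤ r ^ M * (M / (1 - r) + (1 + r) / (2 * (1 - r) ^ 2)) := by positivity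
  linarith

theorem sum_iterationCost (p : ℝ) {N : ℕ} (hN : 1 ≤ N) (m : ℕ) :
    ∑ c ∈ Finset.range (N - 1), iterationCost p N m c 1 =
      ((N : ℝ) - 1) / (2 * p - 1) +
        N * ((N : ℝ) - 1) / p * (((1 - p) / p) ^ m * ((m : ℝ) + 1 / 2)) := by
  obtain ⟨n, rfl⟩ := Nat.exists_eq_add_of_le' hN
  rw [Nat.add_sub_cancel]
  have h : ∀ k : ℕ, ∑ c ∈ Finset.range k, iterationCost p (n + 1) m c 1 =
      k / (2 * p - 1) + ((1 - p) / p) ^ m / p * (k * ((n + 1) * m) + k * (k + 1) / 2) := by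
    intro k
    induction k with
    | zero => simp
    | succ k ih =>
      rw [Finset.sum_range_succ, ih, iterationCost]
      push_cast
      ring
  rw [h n]
  push_cast
  ring

theorem roundsCost_le_explicitCost {p : ℝ} (hp : 1 / 2 < p) (hp1 : p ≤ 1) (β : ℝ) {N : ℕ}
    (hN : 1 ≤ N) (M : ℕ) : roundsCost p β N M 0 1 ≤ explicitCost p β N M := by
  have hp0 : 0 < p := by linarith
  have hd : 0 < 2 * p - 1 := by linarith
  have hN' : (1 : ℝ) ≤ N := by exact_mod_cast hN
  have hs := sum_pow_mul_add_half_le (r := (1 - p) / p) (div_nonneg (by linarith) hp0.le)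
    ((div_lt_one hp0).2 (by linarith)) M
  have e : (1 + (1 - p) / p) / (2 * (1 - (1 - p) / p) ^ 2) = p / (2 * (2 * p - 1) ^ 2) := by
    have h1 : 1 + (1 - p) / p = 1 / p := by field_simp; ring
    have h2 : 1 - (1 - p) / p = (2 * p - 1) / p := by field_simp; ring
    rw [h1, h2]
    field_simp
  rw [e] at hs
  have hc : 0 ≤ N * ((N : ℝ) - 1) / p :=
    div_nonneg (mul_nonneg (by linarith) (by linarith)) hp0.le
  have hs' := mul_le_mul_of_nonneg_left hs hc
  have e2 : N * ((N : ℝ) - 1) / p * (p / (2 * (2 * p - 1) ^ 2)) =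
      N * ((N : ℝ) - 1) / (2 * (2 * p - 1) ^ 2) := by
    field_simp
  rw [e2] at hs'
  unfold roundsCost roundCost explicitCost
  simp only [mul_one, sum_iterationCost p hN, Nat.Ico_zero_eq_range]
  rw [Finset.sum_add_distrib, Finset.sum_add_distrib, Finset.sum_const, Finset.card_range,
    nsmul_eq_mul, ← Finset.mul_sum, ← mul_div_assoc]
  linarith

/-- A geometric sum: of the N-1 duels counted per round, one makes up for the floor and N-2 remain.
-/
theorem pow_add_le_roundTime {β : ℝ} (hβ : 1 < β) {N : ℕ} (hN : 2 ≤ N) (m : ℕ) :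
    β ^ (m + 1) + m * ((N : ℝ) - 2) * (β - 1) ≤ β + roundTime β N m * (β - 1) := by
  obtain ⟨n, rfl⟩ := Nat.exists_eq_add_of_le' hN
  induction m with
  | zero => simp [roundTime]
  | succ m ih =>
    rw [roundTime, Finset.sum_range_succ, ← roundTime]
    have h1 := Nat.lt_floor_add_one (β ^ (m + 1))
    have h2 : n + 2 - 1 = n + 1 := rfl
    rw [h2]
    push_cast at ih ⊢
    have h3 : β ^ (m + 1) * (β - 1) ≤ ((⌊β ^ (m + 1)⌋₊ : ℝ) + 1) * (β - 1) :=
      mul_le_mul_of_nonneg_right h1.le (by linarith)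
    have e : β ^ (m + 1 + 1) = β ^ (m + 1) + β ^ (m + 1) * (β - 1) := by ring
    rw [e]
    linarith

theorem le_roundTime {N : ℕ} (β : ℝ) (hN : 2 ≤ N) (m : ℕ) : m ≤ roundTime β N m := by
  calc m = ∑ _k ∈ Finset.range m, 1 := by simp
    _ ≤ _ := Finset.sum_le_sum fun k _ => by omega

/-- The number of rounds that can start within `T` time periods. -/
theorem exists_rounds {β : ℝ} (hβ : 1 < β) {N : ℕ} (hN : 2 ≤ N) (T : ℕ) :
    ∃ M : ℕ, (∀ m, roundTime β N m + 1 ≤ T → m < M) ∧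
      β ^ M + ((M : ℝ) - 1) * ((N : ℝ) - 2) * (β - 1) ≤ 1 + T * (β - 1) := by
  have hN' : (2 : ℝ) ≤ N := by exact_mod_cast hN
  rcases Nat.eq_zero_or_pos T with rfl | hT
  · refine ⟨0, fun m hm => by omega, ?_⟩
    have : 0 ≤ ((N : ℝ) - 2) * (β - 1) := mul_nonneg (by linarith) (by linarith)
    simp
    linarith
  · have h0 : roundTime β N 0 + 1 ≤ T := by
      simp only [roundTime, Finset.range_zero, Finset.sum_empty]
      omega
    refine ⟨Nat.findGreatest (fun m => roundTime β N m + 1 ≤ T) T + 1, fun m hm => ?_, ?_⟩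
    · refine Nat.lt_succ_of_le (Nat.le_findGreatest ?_ hm)
      have := le_roundTime β hN m
      omega
    · have h := Nat.findGreatest_spec (P := fun m => roundTime β N m + 1 ≤ T) (Nat.zero_le T) h0
      generalize Nat.findGreatest (fun m => roundTime β N m + 1 ≤ T) T = k at h
      have h1 := pow_add_le_roundTime hβ hN k
      have h2 : (roundTime β N k : ℝ) + 1 ≤ T := by exact_mod_cast h
      have h3 := mul_le_mul_of_nonneg_right h2 (by linarith : 0 ≤ β - 1)
      push_cast
      rw [add_sub_cancel_right]
      linarith

theorem le_log_div_log {β y : ℝ} (hβ : 1 < β) {M : ℕ} (h : β ^ M ≤ y) :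
    (M : ℝ) * Real.log β ≤ Real.log y := by
  rw [← Real.log_pow]
  exact Real.log_le_log (by positivity) h

theorem mul_log_le_mul_log {x y : ℝ} (hx : 0 < x) {a b : ℕ} (h : x ^ a ≤ y ^ b) :
    a * Real.log x ≤ b * Real.log y := by
  rw [← Real.log_pow, ← Real.log_pow]
  exact Real.log_le_log (by positivity) h

/-- The loss from log(1+x) to log x is absorbed by the quadratic slack in N if β is large, and for
small β by the smaller `D` or by the duelling time in `hM`. Below, L = log x / log β. -/
theorem rounds_mul_le {β x D : ℝ} (hβ : 1 < β) (hx : 2 ≤ x) {N M : ℕ} (hN : 2 ≤ N)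
    (hM : β ^ M + ((M : ℝ) - 1) * ((N : ℝ) - 2) * (β - 1) ≤ 1 + x) (hD : D ≤ M)
    (hD' : β ≤ 7 / 5 → D ≤ M / 4) :
    ((N : ℝ) - 1) * M + D ≤
      N * (Real.log x / Real.log β) + (N : ℝ) ^ 2 / 2 + (N : ℝ) / 2 := by
  have hN' : (2 : ℝ) ≤ N := by exact_mod_cast hN
  have hlβ : 0 < Real.log β := Real.log_pos hβ
  have hlx : 0 < Real.log x := Real.log_pos (by linarith)
  rcases Nat.eq_zero_or_pos M with rfl | hM0
  · simp only [Nat.cast_zero, mul_zero, zero_add] at hD ⊢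
    have : 0 ≤ N * (Real.log x / Real.log β) := by positivity
    nlinarith
  have hM1 : (1 : ℝ) ≤ M := by exact_mod_cast hM0
  have hz0 : 0 ≤ ((M : ℝ) - 1) * (β - 1) := mul_nonneg (by linarith) (by linarith)
  have hMx : β ^ M ≤ 1 + x := by nlinarith [mul_nonneg hz0 (by linarith : 0 ≤ (N : ℝ) - 2)]
  have hMl := le_log_div_log hβ hMx
  rcases le_total (7 / 5) β with hβ' | hβ'
  -- Here M ≤ L + 3/2, and 3N/2 ≤ N²/2 + N/2 because N ≥ 2.
  · have h1 : Real.log (1 + x) ≤ Real.log x + Real.log (3 / 2) := by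
      rw [← Real.log_mul (by linarith) (by norm_num)]
      exact Real.log_le_log (by linarith) (by linarith)
    have h2 : 2 * Real.log (3 / 2) ≤ 3 * Real.log (7 / 5) := by
      have := mul_log_le_mul_log (x := 3 / 2) (y := 7 / 5) (a := 2) (b := 3) (by norm_num)
        (by norm_num)
      exact_mod_cast this
    have h3 : Real.log (7 / 5) ≤ Real.log β := Real.log_le_log (by norm_num) hβ'
    have h4 : (M : ℝ) ≤ Real.log x / Real.log β + 3 / 2 := by
      rw [← sub_le_iff_le_add, le_div_iff₀ hlβ]
      linarith
    nlinarith
  · specialize hD' hβ'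
    rcases hN.eq_or_lt with h2 | h3
    · subst h2
      have h1 : 5 * Real.log (1 + x) ≤ 8 * Real.log x := by
        have := mul_log_le_mul_log (x := 1 + x) (y := x) (a := 5) (b := 8) (by linarith) (by
          calc (1 + x) ^ 5 ≤ (3 / 2 * x) ^ 5 := by gcongr; linarith
            _ = 243 / 32 * x ^ 5 := by ring
            _ ≤ x ^ 3 * x ^ 5 := by
              gcongr
              calc (243 / 32 : ℝ) ≤ 2 ^ 3 := by norm_num
                _ ≤ x ^ 3 := by gcongr
            _ = x ^ 8 := by ring)
        exact_mod_cast this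
      have h4 : 5 / 4 * (M : ℝ) ≤ 2 * (Real.log x / Real.log β) := by
        rw [← mul_div_assoc, le_div_iff₀ hlβ]
        linarith
      push_cast
      linarith
    · have hN3 : (3 : ℝ) ≤ N := by exact_mod_cast h3
      rcases lt_or_ge (((M : ℝ) - 1) * (β - 1)) (2 / 3) with hz | hz
      · have h1 : Real.log β ≤ β - 1 := Real.log_le_sub_one_of_pos (by linarith)
        have h2 : ((M : ℝ) - 1) * Real.log β ≤ ((M : ℝ) - 1) * (β - 1) :=
          mul_le_mul_of_nonneg_left h1 (by linarith)
        have h4 : Real.log 2 ≤ Real.log x := Real.log_le_log (by norm_num) hx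
        have h5 := Real.log_two_gt_d9
        have h6 : (M : ℝ) ≤ Real.log x / Real.log β + 1 := by
          rw [← sub_le_iff_le_add, le_div_iff₀ hlβ]
          linarith
        nlinarith
      · rcases (Nat.succ_le_of_lt h3).eq_or_lt with h3 | h4
        · have hN3' : (N : ℝ) = 3 := by exact_mod_cast h3.symm
          rw [hN3'] at hM ⊢
          have h1 := le_log_div_log hβ (y := 7 / 6 * x) (M := M) (by linarith)
          have h5 : 3 * Real.log (7 / 6 * x) ≤ 4 * Real.log x := by
            have := mul_log_le_mul_log (x := 7 / 6 * x) (y := x) (a := 3) (b := 4) (by linarith)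
              (by
                calc (7 / 6 * x) ^ 3 = 343 / 216 * x ^ 3 := by ring
                  _ ≤ x * x ^ 3 := by
                    gcongr
                    linarith
                  _ = x ^ 4 := by ring)
            exact_mod_cast this
          have h6 : 9 / 4 * (M : ℝ) ≤ 3 * (Real.log x / Real.log β) := by
            rw [← mul_div_assoc, le_div_iff₀ hlβ]
            linarith
          linarith
        · have hN4 : (4 : ℝ) ≤ N := by exact_mod_cast h4
          have h1 := le_log_div_log hβ (y := x) (M := M) (by nlinarith)
          have h6 : (M : ℝ) ≤ Real.log x / Real.log β := by
            rwa [le_div_iff₀ hlβ]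
          nlinarith

section Bounds

variable {p β : ℝ} {N M : ℕ}

theorem sum_pow_le (hp : 1 / 2 < p) (hp1 : p ≤ 1) (hβ : 1 < β) (hβp : β * (1 - p) < p) {c : ℝ}
    (hc : 0 ≤ c) (M : ℕ) :
    c * ∑ k ∈ Finset.range M, (β * ((1 - p) / p)) ^ (k + 1) ≤
      M * (c * (β * ((1 - p) / p))) := by
  have hp0 : 0 < p := by linarith
  have h0 : 0 ≤ β * ((1 - p) / p) :=
    mul_nonneg (by linarith) (div_nonneg (by linarith) hp0.le)
  have h1 : β * ((1 - p) / p) ≤ 1 := by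
    rw [← mul_div_assoc, div_le_one hp0]
    exact hβp.le
  rw [Finset.mul_sum]
  calc _ ≤ ∑ _k ∈ Finset.range M, c * (β * ((1 - p) / p)) := by
        refine Finset.sum_le_sum fun k _ => mul_le_mul_of_nonneg_left ?_ hc
        rw [pow_succ]
        exact mul_le_of_le_one_left h0 (pow_le_one₀ h0 h1)
    _ = _ := by simp

theorem mul_ratio_le_one (hp : 1 / 2 < p) (hβp : β * (1 - p) < p) :
    β * ((1 - p) / p) ≤ 1 := by
  rw [← mul_div_assoc, div_le_one (by linarith)]
  exact hβp.le

theorem explicitCost_le (hp : 1 / 2 < p) (hp1 : p ≤ 1) (hβ : 1 < β) (hβp : β * (1 - p) < p)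
    (hN : 2 ≤ N) {x : ℝ} (hx : 0 ≤ x)
    (hM : β ^ M + ((M : ℝ) - 1) * ((N : ℝ) - 2) * (β - 1) ≤ 1 + x) :
    explicitCost p β N M ≤ (N : ℝ) ^ 2 * p / (2 * p - 1) ^ 2
      + N * Real.log (1 + x) / ((2 * p - 1) * Real.log β) := by
  have hN' : (2 : ℝ) ≤ N := by exact_mod_cast hN
  have hd : 0 < 2 * p - 1 := by linarith
  have hlβ : 0 < Real.log β := Real.log_pos hβ
  have hMl : (M : ℝ) * Real.log β ≤ Real.log (1 + x) := by
    rcases Nat.eq_zero_or_pos M with rfl | hM0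
    · rw [Nat.cast_zero, zero_mul]
      exact Real.log_nonneg (by linarith)
    · have hM1 : (1 : ℝ) ≤ M := by exact_mod_cast hM0
      have : 0 ≤ ((M : ℝ) - 1) * ((N : ℝ) - 2) * (β - 1) :=
        mul_nonneg (mul_nonneg (by linarith) (by linarith)) (by linarith)
      exact le_log_div_log hβ (by linarith)
  have hS : ∑ k ∈ Finset.range M, (β * ((1 - p) / p)) ^ (k + 1) ≤ M / (2 * p - 1) := by
    have h := sum_pow_le hp hp1 hβ hβp zero_le_one M
    have h1 := mul_ratio_le_one hp hβp
    rw [one_mul, one_mul] at h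
    refine h.trans ((mul_le_of_le_one_right (Nat.cast_nonneg M) h1).trans ?_)
    rw [le_div_iff₀ hd]
    exact mul_le_of_le_one_right (Nat.cast_nonneg M) (by linarith)
  have h1 : N * ((N : ℝ) - 1) / (2 * (2 * p - 1) ^ 2) ≤ (N : ℝ) ^ 2 * p / (2 * p - 1) ^ 2 := by
    rw [div_le_div_iff₀ (by positivity) (by positivity)]
    have : N * ((N : ℝ) - 1) ≤ (N : ℝ) ^ 2 * p * 2 := by nlinarith
    have := mul_le_mul_of_nonneg_right this (sq_nonneg (2 * p - 1))
    linarith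
  have h2 : (M : ℝ) * N / (2 * p - 1) ≤ N * Real.log (1 + x) / ((2 * p - 1) * Real.log β) := by
    rw [div_le_div_iff₀ hd (by positivity)]
    have := mul_le_mul_of_nonneg_left hMl (by positivity : 0 ≤ (N : ℝ) * (2 * p - 1))
    linarith
  have h3 : (M : ℝ) * ((N : ℝ) - 1) / (2 * p - 1) + M / (2 * p - 1) = M * N / (2 * p - 1) := by
    ring
  unfold explicitCost
  linarith

theorem explicitCost_le_of_two_le (hp : 1 / 2 < p) (hp1 : p ≤ 1) (hβ : 1 < β)
    (hβp : β * (1 - p) < p) (hN : 2 ≤ N) {x : ℝ} (hx : 2 ≤ x)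
    (hM : β ^ M + ((M : ℝ) - 1) * ((N : ℝ) - 2) * (β - 1) ≤ 1 + x) :
    explicitCost p β N M ≤ (N : ℝ) ^ 2 * p / (2 * p - 1) ^ 2
      + N * Real.log x / ((2 * p - 1) * Real.log β) := by
  have hp0 : 0 < p := by linarith
  have hd : 0 < 2 * p - 1 := by linarith
  have hlβ : 0 < Real.log β := Real.log_pos hβ
  have hMn : (0 : ℝ) ≤ M := Nat.cast_nonneg M
  have hr := mul_ratio_le_one hp hβp
  have hS := sum_pow_le hp hp1 hβ hβp hd.le M
  obtain ⟨S, hSe⟩ : ∃ S, S = ∑ k ∈ Finset.range M, (β * ((1 - p) / p)) ^ (k + 1) := ⟨_, rfl⟩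
  rw [← hSe] at hS
  have hD : (2 * p - 1) * S ≤ M := by
    refine hS.trans (mul_le_of_le_one_right hMn ?_)
    nlinarith
  have hD' : β ≤ 7 / 5 → (2 * p - 1) * S ≤ M / 4 := by
    intro hβ'
    -- The maximum over p is 3 - 2√2 < 5/28, and 7/5 · 5/28 = 1/4. The square is centred at the
    -- vertex of 56p² - 79p + 28.
    have h1 : (2 * p - 1) * ((1 - p) / p) ≤ 5 / 28 := by
      rw [← mul_div_assoc, div_le_div_iff₀ hp0 (by norm_num)]
      nlinarith [sq_nonneg (112 * p - 79)]
    have h0 : 0 ≤ (2 * p - 1) * ((1 - p) / p) :=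
      mul_nonneg hd.le (div_nonneg (by linarith) hp0.le)
    have h2 : (2 * p - 1) * (β * ((1 - p) / p)) ≤ 1 / 4 := by nlinarith
    nlinarith
  have key := rounds_mul_le hβ hx hN hM hD hD'
  have hN0 : (0 : ℝ) ≤ N := Nat.cast_nonneg N
  -- With p = (d+1)/2, removing N(N-1)/(2d²) from N²p/d² leaves (N²/2 + N/2)/d + N(1-p)/d²; hence
  -- the constants of `rounds_mul_le`.
  have e : (N : ℝ) ^ 2 * p / (2 * p - 1) ^ 2 + N * Real.log x / ((2 * p - 1) * Real.log β) -
      explicitCost p β N M =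
      (N * (Real.log x / Real.log β) + (N : ℝ) ^ 2 / 2 + (N : ℝ) / 2 -
        (((N : ℝ) - 1) * M + (2 * p - 1) * S)) / (2 * p - 1) +
        N * (1 - p) / (2 * p - 1) ^ 2 := by
    obtain ⟨d, hde⟩ : ∃ d, 2 * p - 1 = d := ⟨_, rfl⟩
    have hpe : p = (d + 1) / 2 := by linarith
    have hd0 : d ≠ 0 := hde ▸ hd.ne'
    unfold explicitCost
    rw [← hSe, hde, hpe]
    field_simp
    ring
  have h1 : 0 ≤ (N * (Real.log x / Real.log β) + (N : ℝ) ^ 2 / 2 + (N : ℝ) / 2 -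
        (((N : ℝ) - 1) * M + (2 * p - 1) * S)) / (2 * p - 1) :=
    div_nonneg (by linarith) hd.le
  have h2 : 0 ≤ N * (1 - p) / (2 * p - 1) ^ 2 :=
    div_nonneg (mul_nonneg hN0 (by linarith)) (by positivity)
  linarith

theorem log_bound_le (hp : 1 / 2 < p) (hβ : 1 < β) (hN : 1 ≤ N) {T : ℕ} (hT : 1 ≤ T) :
    (N : ℝ) ^ 2 * p / (2 * p - 1) ^ 2
        + N * Real.log (1 + T * (β - 1)) / ((2 * p - 1) * Real.log β) ≤
      (p / (2 * p - 1) ^ 2 + 1 / (2 * p - 1) + 1 / ((2 * p - 1) * Real.log β)) *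
        ((N : ℝ) ^ 2 + N * Real.log T) := by
  have hp0 : 0 < p := by linarith
  have hd : 0 < 2 * p - 1 := by linarith
  have hlβ : 0 < Real.log β := Real.log_pos hβ
  have hT' : (1 : ℝ) ≤ T := by exact_mod_cast hT
  have hN' : (1 : ℝ) ≤ N := by exact_mod_cast hN
  have hlT : 0 ≤ Real.log T := Real.log_nonneg hT'
  -- For T ≥ 1, 1 + T(β-1) ≤ Tβ.
  have h1 : Real.log (1 + T * (β - 1)) ≤ Real.log T + Real.log β := by
    rw [← Real.log_mul (by linarith) (by linarith)]
    exact Real.log_le_log (by nlinarith) (by nlinarith)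
  have h2 : N * Real.log (1 + T * (β - 1)) / ((2 * p - 1) * Real.log β) ≤
      1 / (2 * p - 1) * N + 1 / ((2 * p - 1) * Real.log β) * (N * Real.log T) := by
    have e : 1 / (2 * p - 1) * N + 1 / ((2 * p - 1) * Real.log β) * (N * Real.log T) =
        N * (Real.log T + Real.log β) / ((2 * p - 1) * Real.log β) := by
      field_simp
      ring
    rw [e]
    gcongr
  have h3 : 1 / (2 * p - 1) * N ≤ 1 / (2 * p - 1) * (N : ℝ) ^ 2 := by
    gcongr
    nlinarith
  have h4 : 0 ≤ 1 / (2 * p - 1) * (N * Real.log T) := by positivity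
  have h5 : 0 ≤ p / (2 * p - 1) ^ 2 * (N * Real.log T) := by positivity
  have h6 : 0 ≤ 1 / ((2 * p - 1) * Real.log β) * (N : ℝ) ^ 2 := by positivity
  have e : (N : ℝ) ^ 2 * p / (2 * p - 1) ^ 2 = p / (2 * p - 1) ^ 2 * (N : ℝ) ^ 2 := by ring
  rw [e]
  linarith

theorem continuousAt_explicitCost (hp : 1 / 2 < p) (β : ℝ) (N M : ℕ) :
    ContinuousAt (fun q => explicitCost q β N M) p := by
  have hp0 : p ≠ 0 := by linarith
  have hd : 2 * p - 1 ≠ 0 := by linarith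
  have hd2 : 2 * (2 * p - 1) ^ 2 ≠ 0 := by positivity
  unfold explicitCost
  fun_prop (disch := assumption)

end Bounds

/-! ### From parameters below `p` to `p` itself. -/

namespace Preferences

variable {A : Type u} {P : Preferences A} {w : A} {p : ℝ}

theorem IsMinPreference.le_one (hp : P.IsMinPreference p) : p ≤ 1 := by
  obtain ⟨_, i, j, h⟩ := hp.1
  linarith [P.prob_add_swap i j, P.prob_nonneg j i]

theorem IsCondorcetWinner.hasGap (hw : P.IsCondorcetWinner w) (hp : P.IsMinPreference p) {q : ℝ}
    (hq : q ≤ p) : P.HasGap w q where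
  best := fun i hi => hq.trans (hp.2 ⟨hw i hi, w, i, rfl⟩)
  gap := fun i j => by
    rcases lt_trichotomy (P.prob i j) (1 / 2) with h | h | h
    · have hs := P.prob_add_swap i j
      have : p ≤ P.prob j i := hp.2 ⟨by linarith, j, i, rfl⟩
      exact Or.inr (Or.inr (by linarith))
    · exact Or.inr (Or.inl h)
    · exact Or.inl (hq.trans (hp.2 ⟨h, i, j, rfl⟩))

end Preferences

/-- The gap condition persists for q < p ≤ 1, where the weight is positive. As `M` does not depend
on q and `explicitCost` is continuous in it, q may tend to `p`, which includes p = 1. -/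
theorem WSS.expectedStrongRegret_le_explicitCost {A : Type u} [DecidableEq A] [Fintype A]
    [Nontrivial A] {P : Preferences A} {w : A} {p β : ℝ} (hw : P.IsCondorcetWinner w)
    (hp : P.IsMinPreference p) (hβ : 0 ≤ β) {T M : ℕ}
    (hM : ∀ m, roundTime β (Fintype.card A) m + 1 ≤ T → m < M) :
    expectedStrongRegret P β w T ≤ ENNReal.ofReal (explicitCost p β (Fintype.card A) M) := by
  have hlt : ∀ q, 1 / 2 < q → q < p →
      expectedStrongRegret P β w T ≤ ENNReal.ofReal (explicitCost q β (Fintype.card A) M) := by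
    intro q hq hqp
    have hq1 : q < 1 := hqp.trans_le hp.le_one
    exact (expectedStrongRegret_le_roundsCost
      ⟨hw.hasGap hp hqp.le, hq, hq1, hβ, hM⟩).trans (ENNReal.ofReal_le_ofReal
        (roundsCost_le_explicitCost hq hq1.le β Fintype.card_pos M))
  have hp2 : 1 / 2 < p := hp.1.1
  have hc : Tendsto (fun q => ENNReal.ofReal (explicitCost q β (Fintype.card A) M)) (𝓝[<] p)
      (𝓝 (ENNReal.ofReal (explicitCost p β (Fintype.card A) M))) :=
    (ENNReal.continuous_ofReal.tendsto _).comp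
      ((continuousAt_explicitCost hp2 β _ M).tendsto.mono_left nhdsWithin_le_nhds)
  refine ge_of_tendsto hc ?_
  filter_upwards [Ioo_mem_nhdsLT hp2] with q hq
  exact hlt q hq.1 hq.2

end DuelingBandits

end

theorem theorem4 (p β : ℝ) (hβ : 1 < β) (hβp : β * (1 - p) < p) :
    ∃ K : ℝ, ∀ (A : Type u) [DecidableEq A] [Fintype A] [Nontrivial A]
      (P : DuelingBandits.Preferences A) (w : A),
      P.IsCondorcetWinner w → P.IsMinPreference p → ∀ T : ℕ,
        DuelingBandits.WSS.expectedStrongRegret P β w T ≤ ENNReal.ofReal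
          ((Fintype.card A : ℝ) ^ 2 * p / (2 * p - 1) ^ 2
            + (Fintype.card A : ℝ) * Real.log (1 + (T : ℝ) * (β - 1))
              / ((2 * p - 1) * Real.log β)) ∧
        (2 ≤ (T : ℝ) * (β - 1) →
          DuelingBandits.WSS.expectedStrongRegret P β w T ≤ ENNReal.ofReal
            ((Fintype.card A : ℝ) ^ 2 * p / (2 * p - 1) ^ 2
              + (Fintype.card A : ℝ) * Real.log ((T : ℝ) * (β - 1))
                / ((2 * p - 1) * Real.log β))) ∧
        (1 ≤ T →
          DuelingBandits.WSS.expectedStrongRegret P β w T ≤ ENNReal.ofReal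
            (K * ((Fintype.card A : ℝ) ^ 2 + (Fintype.card A : ℝ) * Real.log (T : ℝ)))) := by
  refine ⟨p / (2 * p - 1) ^ 2 + 1 / (2 * p - 1) + 1 / ((2 * p - 1) * Real.log β), ?_⟩
  intro A _ _ _ P w hw hp T
  have hN : 2 ≤ Fintype.card A := Fintype.one_lt_card
  have hp2 : 1 / 2 < p := hp.1.1
  obtain ⟨M, hM, hMx⟩ := DuelingBandits.exists_rounds hβ hN T
  have h := DuelingBandits.WSS.expectedStrongRegret_le_explicitCost hw hp
    (zero_le_one.trans hβ.le) hM
  have h1 := DuelingBandits.explicitCost_le hp2 hp.le_one hβ hβp hN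
    (mul_nonneg (Nat.cast_nonneg T) (by linarith)) hMx
  exact ⟨h.trans (ENNReal.ofReal_le_ofReal h1),
    fun hx => h.trans (ENNReal.ofReal_le_ofReal
      (DuelingBandits.explicitCost_le_of_two_le hp2 hp.le_one hβ hβp hN hx hMx)),
    fun hT => h.trans (ENNReal.ofReal_le_ofReal (h1.trans
      (DuelingBandits.log_bound_le hp2 hβ (one_le_two.trans hN) hT)))⟩
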